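/- Let $m \ge 0$ be a fixed integer. An instance of $m$-stage Hamming distance recoverable robust 3-Satisfiability consists of a finite set of variables with its set $L$ of literals, a list $C \subseteq L^3$ of clauses (with three literals each, repetitions allowed), a base scenario $\sigma_0 \subseteq L$, and for each stage $i = 1, \dots, m$ a succinctly encoded set $\mathsf S_i$ of recovery scenarios $\sigma \subseteq L$ and a bound $\kappa_i \in \mathbb N$ (numbers are written in binary). A scenario $\sigma \subseteq L$ is a set of active literals. A solution of $\sigma$ is a set $\mathtt s \subseteq \sigma$ (the active literals that are set to true) which contains exactly one of $\ell, \overline\ell$ whenever both are in $\sigma$, and which contains a literal of every clause of $C$ all of whose literals are in $\sigma$ (clauses with an inactive literal are discarded). With the Hamming distance $H(\mathtt s, \mathtt t) = |\mathtt s \mathbin{\triangle} \mathtt t|$, the question is whether $$\exists \mathtt s_0\ \forall \sigma_1 \in \mathsf S_1\ \exists \mathtt s_1\ \forall \sigma_2 \in \mathsf S_2\ \exists \mathtt s_2 \cdots \forall \sigma_m \in \mathsf S_m\ \exists \mathtt s_m$$ such that $\mathtt s_i$ is a solution of $\sigma_i$ for $0 \le i \le m$ and $H(\mathtt s_{i-1},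 \mathtt s_i) \le \kappa_i$ for $1 \le i \le m$. Two encodings of a set of scenarios are considered. - xor-dependencies: $(E', \{(E_{1,1}, E_{1,2}), \dots, (E_{n,1}, E_{n,2})\})$, where $E'$ and the $E_{j,k}$ are pairwise disjoint sets of literals. The scenarios are the sets $E' \cup E_1 \cup \dots \cup E_n$ with $E_j \in \{E_{j,1}, E_{j,2}\}$ for every $j$. (All pairs are written out, so their number $n$ is at most linear in the length of the input.) - $\Gamma$-set scenarios: $(E', \{E_1, \dots, E_n\})$ and $\Gamma \in \mathbb N$, where $E', E_1, \dots, E_n$ are pairwise disjoint sets of literals. The scenarios are the unions of $E'$ with at most $\Gamma$ of the sets $E_1, \dots, E_n$. For $k \ge 0$ let $\Sigma^p_k$ be the class of languages $A$ for which there are a polynomial-time computable verifier $V$ and a polynomial $p$ such that $x \in A$ if and only if $\exists w_1 \forall w_2 \exists w_3 \cdots Q w_k : V(x, w_1, \dots, w_k) = 1$, where the $k$ quantifiers alternate, start with $\exists$, and range over the bit strings of length at most $p(|x|)$. Theorem. For every $m \ge 0$, $m$-stage Hamming distance recoverable robust 3-Satisfiability with a linear number of xor-dependencies is in $\Sigma^p_{2m+1}$,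 and $m$-stage Hamming distance recoverable robust 3-Satisfiability with $\Gamma$-set scenarios is in $\Sigma^p_{2m+1}$. -/

import Mathlib

open scoped symmDiff

namespace HDRR

/-! ### The classes `Σₖᵖ` of the polynomial hierarchy -/

section PolynomialHierarchy

/-- The string handed to a verifier: the input word `x`, followed by the words `w₁, w₂, …` of the
guesses, each preceded by the separator `none`. -/
def verifierInput {α : Type} (a : List α × List (List Bool)) : List (Option (α ⊕ Bool)) :=
  a.1.map (fun c => some (Sum.inl c)) ++
    a.2.flatMap (fun w => none :: w.map (fun b => some (Sum.inr b)))

/-- `alternation B true k P` is `∃ w₁ ∀ w₂ ∃ w₃ … Q wₖ, P [w₁, …, wₖ]`, and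
`alternation B false k P` is the same with the roles of `∃` and `∀` exchanged; all the quantifiers
range over the bit strings of length at most `B`. -/
def alternation (B : ℕ) : Bool → ℕ → (List (List Bool) → Prop) → Prop
  | _, 0, P => P []
  | true, k + 1, P =>
      ∃ w : List Bool, w.length ≤ B ∧ alternation B false k (fun ws => P (w :: ws))
  | false, k + 1, P =>
      ∀ w : List Bool, w.length ≤ B → alternation B true k (fun ws => P (w :: ws))

/-- The class `Σₖᵖ` of languages over a finite alphabet `α`: there are a verifier `V`, computed by
a Turing machine in time polynomial in the length of its input, and a polynomial `p` such that
`x ∈ L ↔ ∃ w₁ ∀ w₂ ∃ w₃ … Q wₖ, V (x, w₁, …, wₖ) = 1`, where the quantifiers alternate, start with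
`∃`, and range over the bit strings of length at most `p (|x|)`. -/
def SigmaP (α : Type) [Fintype α] (k : ℕ) : Set (Language α) :=
  {L | ∃ (V : List α × List (List Bool) → Bool) (p : Polynomial ℕ),
    Nonempty (Turing.TM2ComputableInPolyTime verifierInput Computability.encodeBool V) ∧
    ∀ x : List α,
      x ∈ L ↔ alternation (p.eval x.length) true k (fun ws => V (x, ws) = true)}

end PolynomialHierarchy

/-! ### 3-Satisfiability under scenarios -/

/-- A literal: the index of a variable and a sign, `true` for the variable itself and `false` for
its negation. -/
abbrev Literal : Type := ℕ × Bool

/-- A clause of 3-Satisfiability: a triple of literals, repetitions being allowed. -/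
abbrev Clause : Type := Literal × Literal × Literal

/-- The three literals of a clause. -/
def Clause.literals (c : Clause) : List Literal := [c.1, c.2.1, c.2.2]

/-- `s` is a solution of the scenario with the set `σ` of active literals: `s` is the set of the
active literals that are set to true. If a literal and its negation are both active, exactly one of
them is set to true. The clauses of `C` that contain an inactive literal are discarded, and every
other one has to contain a literal that is set to true. -/
def IsSolution (C : List Clause) (σ s : Finset Literal) : Prop :=
  s ⊆ σ ∧
  (∀ v : ℕ, (v, true) ∈ σ → (v, false) ∈ σ → ((v, true) ∈ s ↔ (v, false) ∉ s)) ∧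
  ∀ c ∈ C, (∀ l ∈ Clause.literals c, l ∈ σ) → ∃ l ∈ Clause.literals c, l ∈ s

/-- The Hamming distance of two sets of literals. -/
def hamming (s t : Finset Literal) : ℕ := (s ∆ t).card

/-- Recoverability from the solution `s` through a list of stages `(S, κ)`, where `S` is a set of
scenarios and `κ` the bound on the Hamming distance: for every scenario of the first stage there is
a solution within the bound from which one can recover through the remaining stages. -/
def Recoverable (C : List Clause) : List (Set (Finset Literal) × ℕ) → Finset Literal → Prop
  | [], _ => True
  | (S, κ) :: rest, s =>
      ∀ σ ∈ S, ∃ t, IsSolution C σ t ∧ hamming s t ≤ κ ∧ Recoverable C rest t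

/-! ### Writing finite data as words

Mathlib's alphabet `Γ'` consists of the two bits, two brackets, a comma and a blank. -/

section Words

open Computability

/-- A natural number in binary, closed by a comma. -/
def encodeNumber (n : ℕ) : List Γ' := (encodeNat n).map Γ'.bit ++ [Γ'.comma]

/-- A list: its entries one after the other between brackets. -/
def encodeList {β : Type} (e : β → List Γ') (l : List β) : List Γ' :=
  Γ'.bra :: (l.flatMap e ++ [Γ'.ket])

/-- A literal: its sign, followed by its variable. -/
def encodeLiteral (l : Literal) : List Γ' := Γ'.bit l.2 :: encodeNumber l.1

/-- A clause: its three literals. -/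
def encodeClause (c : Clause) : List Γ' := (Clause.literals c).flatMap encodeLiteral

end Words

/-! ### Succinct encodings of sets of scenarios -/

/-- A way of encoding sets of scenarios: an encoding `e : T` is built from the sets `parts e` of
literals, it encodes the set `scenarios e` of scenarios (each given by its set of active literals),
and it is written as the word `word e`. -/
class ScenarioEncoding (T : Type) where
  parts : T → List (List Literal)
  scenarios : T → Set (Finset Literal)
  word : T → List Computability.Γ'

/-- The data `(E', {(E₁₁, E₁₂), …, (Eₙ₁, Eₙ₂)})` of `n` xor-dependencies. Every pair is
written out in the word of an instance, so `n` is at most the length of that word. -/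
structure XorDependencies where
  fixed : List Literal
  pairs : List (List Literal × List Literal)

/-- The scenarios given by xor-dependencies are the sets `E' ∪ E₁ ∪ … ∪ Eₙ` where each `Eᵢ` is
one of `Eᵢ₁` and `Eᵢ₂`. -/
instance : ScenarioEncoding XorDependencies where
  parts e := e.fixed :: e.pairs.flatMap (fun q => [q.1, q.2])
  scenarios e := {σ | ∃ chosen : List (List Literal),
    List.Forall₂ (fun q E => E = q.1 ∨ E = q.2) e.pairs chosen ∧
    σ = (e.fixed ++ chosen.flatten).toFinset}
  word e := encodeList encodeLiteral e.fixed ++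
    encodeList (fun q => encodeList encodeLiteral q.1 ++ encodeList encodeLiteral q.2) e.pairs

/-- The data `(E', {E₁, …, Eₙ})` and `Γ` of `Γ`-set scenarios. -/
structure GammaSets where
  fixed : List Literal
  sets : List (List Literal)
  gamma : ℕ

/-- The `Γ`-set scenarios are the unions of `E'` and at most `Γ` of the sets `E₁, …, Eₙ`. -/
instance : ScenarioEncoding GammaSets where
  parts e := e.fixed :: e.sets
  scenarios e := {σ | ∃ chosen : List (List Literal),
    List.Sublist chosen e.sets ∧ chosen.length ≤ e.gamma ∧
    σ = (e.fixed ++ chosen.flatten).toFinset}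
  word e := encodeList encodeLiteral e.fixed ++ encodeList (encodeList encodeLiteral) e.sets ++
    encodeNumber e.gamma

/-! ### Multi-stage Hamming distance recoverable robust 3-Satisfiability -/

/-- An instance: the variables, the clauses, the base scenario, and for every stage the encoding of
its set of recovery scenarios together with the bound `κ` on the Hamming distance. Lists stand for
the sets of their entries. -/
structure Instance (T : Type) where
  vars : List ℕ
  clauses : List Clause
  base : List Literal
  stages : List (T × ℕ)

namespace Instance

variable {T : Type} [ScenarioEncoding T]

/-- All literals that occur belong to the variables of the instance, and within each encoding of a
set of scenarios the sets from which it is built are pairwise disjoint. -/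
def WellFormed (I : Instance T) : Prop :=
  (∀ c ∈ I.clauses, ∀ l ∈ Clause.literals c, l.1 ∈ I.vars) ∧
  (∀ l ∈ I.base, l.1 ∈ I.vars) ∧
  ∀ st ∈ I.stages,
    (∀ E ∈ ScenarioEncoding.parts st.1, ∀ l ∈ E, l.1 ∈ I.vars) ∧
    (ScenarioEncoding.parts st.1).Pairwise List.Disjoint

/-- The base scenario has a solution from which one can recover through all the stages. -/
def IsYes (I : Instance T) : Prop :=
  ∃ s, IsSolution I.clauses I.base.toFinset s ∧
    Recoverable I.clauses (I.stages.map fun st => (ScenarioEncoding.scenarios st.1, st.2)) s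

/-- The instance written as a word. -/
def word (I : Instance T) : List Computability.Γ' :=
  encodeList encodeNumber I.vars ++ encodeList encodeClause I.clauses ++
    encodeList encodeLiteral I.base ++
    encodeList (fun st => ScenarioEncoding.word st.1 ++ encodeNumber st.2) I.stages

end Instance

/-- `m`-stage Hamming distance recoverable robust 3-Satisfiability, with the sets of scenarios
encoded by elements of `T`, as a language: the words of the instances with `m` stages that have a
solution. -/
def multiStage3Sat (T : Type) [ScenarioEncoding T] (m : ℕ) : Language Computability.Γ' :=
  {w | ∃ I : Instance T, I.stages.length = m ∧ I.WellFormed ∧ I.IsYes ∧ I.word = w}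

end HDRR

/-! The `2m + 1` quantifiers of the question become quantifiers over short bit strings. A solution
is a set of literals over the variables, so it is described by two bits per variable. A scenario is
described by one bit per xor-dependency, or by one bit per set for `Γ`-set scenarios. In the second
case some strings select more than `Γ` sets; since scenarios are quantified universally, the
verifier imposes no condition on the rest of the play after such a string. All guesses have length
at most twice that of the input. The conditions on a stage do not mention later guesses, and the
quantifiers range over nonempty sets, so all conditions can be moved behind the quantifiers and
checked at the end. This is `alternation_checkStages`, with `alternation_const_and` for moving the
conditions.

It remains to check solutions, Hamming distances and the format of the input in polynomial time on
an actual stack machine. Values are represented by binary trees in prefix notation. A structured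
language on four stacks is compiled to machine code with exactly the same step count
(`Cmd.steps_code`, `computable_of_run`). `PolyTime` is the class of functions that this language
computes in polynomial time; it is closed under composition, pairing, case distinction and folds
with polynomially bounded accumulators (`PolyTime.foldl_aux`), and all parts of the verifier are
assembled from these rules.

The input is decoded by a total function that inverts the encoding (`readInstance_word`). Encoding
the result again and comparing it with the input detects words that encode no instance. -/

namespace HDRR

open Turing Computability

/-! ### Binary trees as a universal data type -/

/-- Binary trees, the data on which programs operate. -/
inductive Dat
  | nil
  | cons (a b : Dat)

namespace Dat

/-- The tree written in prefix notation. -/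
def bits : Dat → List Bool
  | nil => [false]
  | cons a b => true :: (a.bits ++ b.bits)

/-- The number of nodes, which is the length of `bits`. -/
def size : Dat → ℕ
  | nil => 1
  | cons a b => 1 + (a.size + b.size)

theorem length_bits (d : Dat) : d.bits.length = d.size := by
  induction d with
  | nil => rfl
  | cons a b iha ihb => simp [bits, size, iha, ihb]; omega

end Dat

/-! ### A structured language for four stacks -/

/-- The symbols on the work stacks: a bit or the separator `none`. -/
abbrev Sym : Type := Option Bool

/-- The tree in prefix notation as a word on a work stack. -/
def Dat.word (d : Dat) : List Sym := d.bits.map some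

/-- The names of the work stacks: a main stack for the values, two auxiliary stacks and a stack
for counting. -/
inductive Reg
  | main | aux₁ | aux₂ | count
  deriving DecidableEq

instance : Fintype Reg := ⟨{.main, .aux₁, .aux₂, .count}, by rintro (_ | _ | _ | _) <;> decide⟩

/-- The contents of the work stacks. -/
structure Store where
  main : List Sym
  aux₁ : List Sym
  aux₂ : List Sym
  count : List Sym

namespace Store

/-- The content of one stack. -/
def get (s : Store) : Reg → List Sym
  | .main => s.main
  | .aux₁ => s.aux₁
  | .aux₂ => s.aux₂
  | .count => s.count

/-- Replaces the content of one stack. -/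
def set (s : Store) : Reg → List Sym → Store
  | .main, l => { s with main := l }
  | .aux₁, l => { s with aux₁ := l }
  | .aux₂, l => { s with aux₂ := l }
  | .count, l => { s with count := l }

end Store

/-- Structured stack programs. `pop k f` pops a symbol off the stack `k` and branches on it;
`loop k p` pops a symbol off the stack `k` and, if that is `true`, runs `p` and starts again. -/
inductive Cmd
  | skip
  | push (k : Reg) (g : Sym)
  | pop (k : Reg) (f : Option Sym → Cmd)
  | seq (p q : Cmd)
  | loop (k : Reg) (p : Cmd)

/-- `Run p s s' t`: the program `p` takes the store `s` to the store `s'` in `t` steps. -/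
inductive Run : Cmd → Store → Store → ℕ → Prop
  | skip (s) : Run .skip s s 1
  | push (k g s) : Run (.push k g) s (s.set k (g :: s.get k)) 1
  | pop {k f s s' t} : Run (f (s.get k).head?) (s.set k (s.get k).tail) s' t →
      Run (.pop k f) s s' (t + 1)
  | seq {p q s s' s'' t t'} : Run p s s' t → Run q s' s'' t' → Run (.seq p q) s s'' (t + t')
  | loop_true {k p s s' s'' t t'} : (s.get k).head? = some (some true) →
      Run p (s.set k (s.get k).tail) s' t → Run (.loop k p) s' s'' t' →
      Run (.loop k p) s s'' (t + t' + 1)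
  | loop_exit {k p s} : (s.get k).head? ≠ some (some true) →
      Run (.loop k p) s (s.set k (s.get k).tail) 1

/-! ### Compilation to stack machines -/

namespace Cmd

/-- The labels of the machine code of a program. -/
def Lab : Cmd → Type
  | skip => Unit
  | push _ _ => Unit
  | pop _ f => Option (Σ o, (f o).Lab)
  | seq p q => p.Lab ⊕ q.Lab
  | loop _ p => Option p.Lab

theorem finite_lab (p : Cmd) : Finite p.Lab := by
  induction p with
  | skip => exact inferInstanceAs (Finite Unit)
  | push => exact inferInstanceAs (Finite Unit)
  | pop k f ih => exact inferInstanceAs (Finite (Option (Σ o, (f o).Lab)))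
  | seq p q ihp ihq => exact inferInstanceAs (Finite (p.Lab ⊕ q.Lab))
  | loop k p ih => exact inferInstanceAs (Finite (Option p.Lab))

/-- The label at which the machine code of a program starts. -/
def entry : (p : Cmd) → p.Lab
  | skip => ()
  | push _ _ => ()
  | pop _ _ => (none : Option _)
  | seq p _ => Sum.inl p.entry
  | loop _ _ => (none : Option _)

end Cmd

section Machine

variable {A : Type}

/-- The names of all stacks of the machine. -/
inductive Stk
  | inp | out | work (k : Reg)
  deriving DecidableEq, Fintype

/-- The alphabets of the stacks for the input alphabet `A`. -/
def StkSym (A : Type) : Stk → Type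
  | .inp => A
  | .out => Bool
  | .work _ => Sym

/-- The finite memory: the symbol popped last off a work stack and off the input. -/
abbrev Mem (A : Type) : Type := Option Sym × Option A

/-- The contents of all stacks. -/
def contents (inp : List A) (out : List Bool) (s : Store) : (k : Stk) → List (StkSym A k)
  | .inp => inp
  | .out => out
  | .work k => s.get k

theorem update_contents_work (inp : List A) (out : List Bool) (s : Store) (k : Reg) (l : List Sym) :
    Function.update (contents inp out s) (.work k) l = contents inp out (s.set k l) := by
  funext j
  rcases j with _ | _ | j
  · exact Function.update_of_ne (by simp) _ _
  · exact Function.update_of_ne (by simp) _ _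
  · by_cases h : j = k
    · subst h
      exact (Function.update_self _ _ _).trans (by cases j <;> rfl)
    · refine (Function.update_of_ne (by simpa using h) _ _).trans ?_
      cases j <;> cases k <;> first | rfl | exact absurd rfl h

theorem update_contents_inp (inp inp' : List A) (out : List Bool) (s : Store) :
    Function.update (contents inp out s) .inp inp' = contents inp' out s := by
  funext j
  rcases j with _ | _ | j
  · exact Function.update_self _ _ _
  · exact Function.update_of_ne (by simp) _ _
  · exact Function.update_of_ne (by simp) _ _

theorem update_contents_out (inp : List A) (out out' : List Bool) (s : Store) :
    Function.update (contents inp out s) .out out' = contents inp out' s := by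
  funext j
  rcases j with _ | _ | j
  · exact Function.update_of_ne (by simp) _ _
  · exact Function.update_self _ _ _
  · exact Function.update_of_ne (by simp) _ _

/-- The machine code of a program, for an embedding of its labels and a label to exit to. -/
def Cmd.code {Λ : Type} : (p : Cmd) → (p.Lab → Λ) → Λ → p.Lab → TM2.Stmt (StkSym A) Λ (Mem A)
  | .skip, _, exit, _ => .goto fun _ => exit
  | .push k g, _, exit, _ => .push (.work k) (fun _ => (g : Sym)) (.goto fun _ => exit)
  | .pop k f, e, _, none =>
      .pop (.work k) (fun v (o : Option Sym) => (o, v.2)) (.goto fun v => e (some ⟨v.1, (f v.1).entry⟩))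
  | .pop _ f, e, exit, some ⟨o, l⟩ => (f o).code (fun l => e (some ⟨o, l⟩)) exit l
  | .seq p q, e, _, Sum.inl l => p.code (fun l => e (Sum.inl l)) (e (Sum.inr q.entry)) l
  | .seq _ q, e, exit, Sum.inr l => q.code (fun l => e (Sum.inr l)) exit l
  | .loop k p, e, exit, none =>
      .pop (.work k) (fun v (o : Option Sym) => (o, v.2))
        (.goto fun v => if v.1 = some (some true) then e (some p.entry) else exit)
  | .loop _ p, e, _, some l => p.code (fun l => e (some l)) (e none) l

/-- `Steps f n a b`: `n` steps of `f` lead from `a` to `b`. -/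
def Steps {C : Type} (f : C → Option C) (n : ℕ) (a b : C) : Prop :=
  (flip bind f)^[n] (some a) = some b

theorem Steps.one {C : Type} {f : C → Option C} {a b : C} (h : f a = some b) : Steps f 1 a b := h

theorem Steps.trans {C : Type} {f : C → Option C} {m n : ℕ} {a b c : C} (h : Steps f m a b)
    (h' : Steps f n b c) : Steps f (m + n) a c := by
  unfold Steps at *
  rw [Nat.add_comm, Function.iterate_add_apply, h, h']

variable {Λ : Type} {M : Λ → TM2.Stmt (StkSym A) Λ (Mem A)}

/-- Each elementary command is one machine statement ending in a jump, and sequencing costs nothing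
because the first part jumps directly to the entry of the second; hence the time is exactly `t`. The
label embedding and the exit are arbitrary so that the induction applies to subprograms. The final
memory is left open because it keeps the last popped symbol. -/
theorem Cmd.steps_code {p : Cmd} {s s' : Store} {t : ℕ} (h : Run p s s' t) :
    ∀ (e : p.Lab → Λ) (exit : Λ), (∀ l, M (e l) = p.code e exit l) →
    ∀ (inp : List A) (out : List Bool) (v : Mem A), ∃ v', Steps (TM2.step M) t
      ⟨some (e p.entry), v, contents inp out s⟩ ⟨some exit, v', contents inp out s'⟩ := by
  induction h with
  | skip s =>
    intro e exit hM inp out v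
    refine ⟨v, Steps.one ?_⟩
    rw [TM2.step, hM]; rfl
  | push k g s =>
    intro e exit hM inp out v
    refine ⟨v, Steps.one ?_⟩
    rw [TM2.step, hM]
    simp only [Cmd.code, TM2.stepAux]
    rw [← update_contents_work]; rfl
  | @pop k f s s' t h ih =>
    intro e exit hM inp out v
    obtain ⟨v', hv⟩ := ih (fun l => e (some ⟨_, l⟩)) exit (fun l => hM (some ⟨_, l⟩)) inp out
      ((s.get k).head?, v.2)
    refine ⟨v', ?_⟩
    rw [Nat.add_comm]
    refine Steps.trans (Steps.one ?_) hv
    rw [TM2.step, hM]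
    simp only [Cmd.code, TM2.stepAux, Cmd.entry]
    rw [← update_contents_work]; rfl
  | seq hp hq ihp ihq =>
    intro e exit hM inp out v
    obtain ⟨v₁, h₁⟩ := ihp (fun l => e (Sum.inl l)) _ (fun l => hM (Sum.inl l)) inp out v
    obtain ⟨v₂, h₂⟩ := ihq (fun l => e (Sum.inr l)) exit (fun l => hM (Sum.inr l)) inp out v₁
    exact ⟨v₂, h₁.trans h₂⟩
  | @loop_true k p s s' s'' t t' hs hp hq ihp ihq =>
    intro e exit hM inp out v
    obtain ⟨v₁, h₁⟩ := ihp (fun l => e (some l)) (e none) (fun l => hM (some l)) inp out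
      ((s.get k).head?, v.2)
    obtain ⟨v₂, h₂⟩ := ihq e exit hM inp out v₁
    refine ⟨v₂, ?_⟩
    rw [Nat.add_comm]
    refine Steps.trans (Steps.one ?_) (h₁.trans h₂)
    rw [TM2.step, hM, ← update_contents_work]
    exact congrArg (fun l => some (TM2.Cfg.mk (some l) _ _)) (if_pos hs)
  | @loop_exit k p s hs =>
    intro e exit hM inp out v
    refine ⟨((s.get k).head?, v.2), Steps.one ?_⟩
    rw [TM2.step, hM, ← update_contents_work]
    exact congrArg (fun l => some (TM2.Cfg.mk (some l) _ _)) (if_neg hs)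

/-! ### The machine around a program -/

/-- The labels of the machine that runs the program `p` on the input. -/
inductive TopLab (p : Cmd)
  | start | read | body (l : p.Lab) | write | clean

theorem TopLab.finite (p : Cmd) : Finite (TopLab p) := by
  have := p.finite_lab
  refine Finite.of_surjective (α := Option (Option (Option (Option p.Lab)))) (fun o => match o with
    | none => .start | some none => .read | some (some none) => .write
    | some (some (some none)) => .clean | some (some (some (some l))) => .body l) ?_
  rintro (_ | _ | l | _ | _)
  · exact ⟨none, rfl⟩
  · exact ⟨some none, rfl⟩
  · exact ⟨some (some (some (some l))), rfl⟩
  · exact ⟨some (some none), rfl⟩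
  · exact ⟨some (some (some none)), rfl⟩

/-- Pushes a word onto the main stack. -/
def pushWord : List Sym → TM2.Stmt (StkSym A) Λ (Mem A) → TM2.Stmt (StkSym A) Λ (Mem A)
  | [], q => q
  | g :: w, q => pushWord w (.push (.work .main) (fun _ => (g : Sym)) q)

/-- The last letter is pushed first, so that `w` ends up in its own order. The whole word is one
statement and costs no additional machine step. -/
theorem stepAux_pushWord (w : List Sym) (q : TM2.Stmt (StkSym A) Λ (Mem A)) (v : Mem A)
    (inp : List A) (out : List Bool) (s : Store) :
    TM2.stepAux (pushWord w q) v (contents inp out s) =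
      TM2.stepAux q v (contents inp out { s with main := w ++ s.main }) := by
  induction w generalizing q with
  | nil => rfl
  | cons g w ih =>
    rw [pushWord, ih]
    exact congrArg (TM2.stepAux q v) (update_contents_work inp out { s with main := w ++ s.main } .main _)

open Classical in
/-- Pushes the word `w a` onto the main stack, where `a` is the input symbol in memory. -/
noncomputable def pushSymbol (w : A → List Sym) (q : TM2.Stmt (StkSym A) Λ (Mem A)) :
    List A → TM2.Stmt (StkSym A) Λ (Mem A)
  | [] => q
  | a :: as => .branch (fun v => decide (v.2 = some a)) (pushWord (w a) q) (pushSymbol w q as)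

/-- The number of pushes depends on the symbol in memory, hence the branching over a list of
symbols; only the membership of `a` in that list matters. -/
theorem stepAux_pushSymbol (w : A → List Sym) (q : TM2.Stmt (StkSym A) Λ (Mem A)) (a : A)
    (as : List A) (ha : a ∈ as) (o : Option Sym) (inp : List A) (out : List Bool) (s : Store) :
    TM2.stepAux (pushSymbol w q as) (o, some a) (contents inp out s) =
      TM2.stepAux q (o, some a) (contents inp out { s with main := w a ++ s.main }) := by
  induction as with
  | nil => simp at ha
  | cons b as ih =>
    rw [pushSymbol, TM2.stepAux]
    by_cases h : a = b
    · subst h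
      simp [stepAux_pushWord]
    · have : a ∈ as := by simpa [h] using ha
      simp [h, ih this]

/-- The code of the machine that pushes the tree of the reversed input onto the main stack, runs
the program `p`, writes the root of the resulting tree to the output, and cleans up. -/
noncomputable def topCode [Fintype A] (w : A → List Sym) (p : Cmd) :
    TopLab p → TM2.Stmt (StkSym A) (TopLab p) (Mem A)
  | .start => .push (.work .main) (fun _ => (some false : Sym)) (.goto fun _ => .read)
  | .read => .pop .inp (fun v (o : Option A) => (v.1, o)) <|
      .branch (fun v => v.2.isNone) (.goto fun _ => .body p.entry) <|
      pushSymbol (fun a => some true :: w a) (.goto fun _ => .read) Finset.univ.toList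
  | .body l => p.code .body .write l
  | .write => .pop (.work .main) (fun v (o : Option Sym) => (o, v.2)) <|
      .push .out (fun v => (decide (v.1 = some (some true)) : Bool)) (.goto fun _ => .clean)
  | .clean => .pop (.work .main) (fun v (o : Option Sym) => (o, v.2)) <|
      .branch (fun v => v.1.isNone) (.load (fun _ => (none, none)) .halt) (.goto fun _ => .clean)

/-- The tree of a list of trees. -/
def Dat.ofList : List Dat → Dat
  | [] => .nil
  | a :: l => .cons a (Dat.ofList l)

theorem Dat.word_cons (a b : Dat) : (Dat.cons a b).word = some true :: (a.word ++ b.word) := by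
  simp [Dat.word, Dat.bits]

variable [Fintype A] (c : A → Dat) (p : Cmd)

/-- In prefix notation, putting a constructor bit and the word of `c a` on top of the word of `d`
gives the word of `.cons (c a) d`. So the main stack always holds a single tree, and consuming the
input from the front reverses the list. -/
theorem steps_read (u : List A) (d : Dat) (o : Option Sym) (b : Option A) :
    ∃ b', Steps (TM2.step (topCode (fun a => (c a).word) p)) (u.length + 1)
      ⟨some .read, (o, b), contents u [] ⟨d.word, [], [], []⟩⟩
      ⟨some (.body p.entry), (o, b'),
        contents [] [] ⟨(u.foldl (fun l a => .cons (c a) l) d).word, [], [], []⟩⟩ := by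
  induction u generalizing d b with
  | nil =>
    refine ⟨none, Steps.one ?_⟩
    exact congrArg (fun S => some (TM2.Cfg.mk (some (TopLab.body p.entry)) (o, none) S))
      (update_contents_inp _ _ _ _)
  | cons a u ih =>
    obtain ⟨b', h⟩ := ih (.cons (c a) d) (some a)
    refine ⟨b', ?_⟩
    rw [List.length_cons, Nat.add_comm (u.length + 1) 1]
    refine Steps.trans (Steps.one ?_) h
    refine (congrArg (fun S => some (TM2.stepAux (pushSymbol _ _ _) (o, some a) S))
      (update_contents_inp (a :: u) u [] _)).trans ?_
    rw [stepAux_pushSymbol _ _ _ _ (by simp), Dat.word_cons]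
    rfl

/-- A halting configuration must have empty stacks apart from the output, and the initial memory. -/
theorem steps_clean (w : List Sym) (out : List Bool) (v : Mem A) :
    Steps (TM2.step (topCode (fun a => (c a).word) p)) (w.length + 1)
      ⟨some .clean, v, contents [] out ⟨w, [], [], []⟩⟩
      ⟨none, (none, none), contents [] out ⟨[], [], [], []⟩⟩ := by
  induction w generalizing v with
  | nil =>
    refine Steps.one ?_
    exact congrArg (fun S => some (TM2.Cfg.mk none (none, none) S))
      (update_contents_work _ _ _ .main _)
  | cons g w ih =>
    rw [List.length_cons, Nat.add_comm (w.length + 1) 1]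
    refine Steps.trans (Steps.one ?_) (ih (some g, v.2))
    exact congrArg (fun S => some (TM2.Cfg.mk (some TopLab.clean) (some g, v.2) S))
      (update_contents_work _ _ _ .main _)

/-- Whether the root of a tree is an inner node. -/
def Dat.isCons : Dat → Bool
  | .nil => false
  | .cons _ _ => true

/-- The answer of a program is the first bit of the prefix notation, so a single pop reads it and
the rest can be discarded. -/
theorem Dat.word_eq (d : Dat) : ∃ w, d.word = some d.isCons :: w ∧ w.length < d.size := by
  have h := d.length_bits
  cases d with
  | nil => exact ⟨[], rfl, by simp [Dat.size]⟩
  | cons a b =>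
    refine ⟨a.word ++ b.word, Dat.word_cons a b, ?_⟩
    simp only [Dat.bits, List.length_cons, List.length_append] at h
    simp only [Dat.word, List.length_append, List.length_map]
    omega

theorem steps_top (u : List A) (d : Dat) (t : ℕ)
    (h : Run p ⟨(u.foldl (fun l a => Dat.cons (c a) l) .nil).word, [], [], []⟩
      ⟨d.word, [], [], []⟩ t) :
    ∃ n ≤ u.length + t + d.size + 3, Steps (TM2.step (topCode (fun a => (c a).word) p)) n
      ⟨some .start, (none, none), contents u [] ⟨[], [], [], []⟩⟩
      ⟨none, (none, none), contents [] [d.isCons] ⟨[], [], [], []⟩⟩ := by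
  obtain ⟨b, h₁⟩ := steps_read c p u .nil none none
  obtain ⟨v, h₂⟩ := Cmd.steps_code (M := topCode (fun a => (c a).word) p) h .body .write
    (fun l => rfl) [] [] (none, b)
  obtain ⟨w, hw, hl⟩ := d.word_eq
  have h₃ := steps_clean c p w [d.isCons] (some (some d.isCons), v.2)
  -- The summands are the times for starting, reading, running the program, writing and cleaning.
  refine ⟨1 + ((u.length + 1) + (t + (1 + (w.length + 1)))), by omega,
    Steps.trans (Steps.one ?_) (h₁.trans (h₂.trans (Steps.trans (Steps.one ?_) h₃)))⟩
  · exact congrArg (fun S => some (TM2.Cfg.mk (some TopLab.read) (none, none) S))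
      (update_contents_work _ _ _ .main _)
  · rw [hw]
    have e : Function.update (Function.update
        (contents ([] : List A) [] ⟨some d.isCons :: w, [], [], []⟩) (.work .main) w) .out
        [decide (some (some d.isCons) = some (some true))] =
        contents [] [d.isCons] ⟨w, [], [], []⟩ := by
      rw [update_contents_work]
      refine (update_contents_out _ _ _ _).trans ?_
      cases d.isCons <;> rfl
    exact congrArg (fun S => some (TM2.Cfg.mk (some TopLab.clean) (some (some d.isCons), v.2) S)) e

/-- A program that, in polynomial time, turns the tree of the reversed input into a tree with the
root `V a` gives a machine that computes `V` in polynomial time. -/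
theorem computable_of_run {α : Type} (ea : α → List A) (V : α → Bool)
    (q : Polynomial ℕ) (h : ∀ a, ∃ d t, Dat.isCons d = V a ∧ t + d.size ≤ q.eval (ea a).length ∧
      Run p ⟨((ea a).foldl (fun l a => Dat.cons (c a) l) .nil).word, [], [], []⟩
        ⟨d.word, [], [], []⟩ t) :
    Nonempty (TM2ComputableInPolyTime ea encodeBool V) := by
  classical
  have := TopLab.finite p
  let _ : Fintype (TopLab p) := Fintype.ofFinite _
  let tm : FinTM2 :=
    { K := Stk
      k₀ := .inp
      k₁ := .out
      Γ := StkSym A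
      Λ := TopLab p
      main := .start
      σ := Mem A
      initialState := (none, none)
      Γk₀Fin := inferInstanceAs (Fintype A)
      m := topCode (fun a => (c a).word) p }
  refine ⟨{ tm := tm, inputAlphabet := Equiv.refl A, outputAlphabet := Equiv.refl Bool,
            time := Polynomial.X + q + 3, outputsFun := fun a => ?_ }⟩
  have key : ∃ n ≤ (ea a).length + q.eval (ea a).length + 3,
      (flip bind tm.step)^[n] (some (initList tm (ea a))) = some (haltList tm [V a]) := by
    obtain ⟨d, t, hd, ht, hr⟩ := h a
    obtain ⟨n, hn, hs⟩ := steps_top c p (ea a) d t hr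
    refine ⟨n, by omega, ?_⟩
    have e₁ : initList tm (ea a) = ⟨some .start, (none, none), contents (ea a) [] ⟨[], [], [], []⟩⟩ := by
      unfold initList
      congr 1
      funext k
      rcases k with _ | _ | k
      · rfl
      · rfl
      · cases k <;> rfl
    have e₂ : haltList tm [V a] = ⟨none, (none, none), contents [] [d.isCons] ⟨[], [], [], []⟩⟩ := by
      unfold haltList
      congr 1
      funext k
      rcases k with _ | _ | k
      · rfl
      · rw [hd]; rfl
      · cases k <;> rfl
    rw [e₁, e₂]
    exact hs
  refine { steps := key.choose, evals_in_steps := ?_, steps_le_m := ?_ }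
  -- Input and output are transported along the equivalences of alphabets, which are identities
  -- here.
  · exact (congrArg (fun l => (flip bind tm.step)^[key.choose] (some (initList tm l)))
      (List.map_id (ea a))).trans (key.choose_spec.2.trans
        (congrArg (fun l => some (haltList tm l)) (List.map_id [V a]).symm))
  · refine key.choose_spec.1.trans (le_of_eq ?_)
    simp

end Machine

/-! ### Moving values between the stacks -/

theorem Run.cast {p : Cmd} {s s' s'' : Store} {t t' : ℕ} (h : Run p s s' t) (hs : s' = s'')
    (ht : t = t') : Run p s s'' t' := by
  subst hs ht; exact h

namespace Cmd

/-- Puts a symbol on the auxiliary stacks selected by `x` and `y`. -/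
def store (x y : Bool) (g : Sym) : Cmd :=
  .seq (if x then .push .aux₁ g else .skip) (if y then .push .aux₂ g else .skip)

/-- Moves one symbol of a value, keeping count of the values that remain to be read. -/
def readSymbol (x y : Bool) : Cmd :=
  .pop .main fun
    | some (some true) =>
        .seq (store x y (some true)) (.seq (.push .count (some true)) (.push .count (some true)))
    | some (some false) => .seq (store x y (some false)) (.seq .skip .skip)
    | _ => .skip

/-- Removes a value from the main stack and puts it, reversed, on the auxiliary stacks selected by
`x` and `y`. -/
def read (x y : Bool) : Cmd :=
  .seq (.push .count (some false)) (.seq (.push .count (some true))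
    (.loop .count (readSymbol x y)))

/-- Moves symbols back to the main stack up to the first separator. -/
def unload (k : Reg) : Cmd :=
  .seq (.push .count (some false)) (.seq (.push .count (some true))
    (.loop .count (.pop k fun
      | some (some b) => .seq (.push .main (some b)) (.push .count (some true))
      | _ => .skip)))

/-- Removes the topmost value. -/
def drop : Cmd := read false false

/-- Moves the topmost value to the first auxiliary stack. -/
def save : Cmd := .seq (.push .aux₁ none) (read true false)

/-- Exchanges the two topmost values. -/
def swap : Cmd :=
  .seq save (.seq (.seq (.push .aux₂ none) (read false true)) (.seq (unload .aux₁) (unload .aux₂)))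

/-- Duplicates the topmost value. -/
def dup : Cmd :=
  .seq (.push .aux₁ none) (.seq (.push .aux₂ none) (.seq (read true true)
    (.seq (unload .aux₁) (unload .aux₂))))

/-- Puts a word on the main stack. -/
def write : List Sym → Cmd
  | [] => .skip
  | g :: w => .seq (write w) (.push .main g)

end Cmd

/-- Prefixes a word if the condition holds. -/
def prefixIf (x : Bool) (l r : List Sym) : List Sym := if x then l ++ r else r

/-! ### Execution rules with all four stacks displayed -/

section Rules

variable {M R T C : List Sym} {g : Sym} {s s' : Store} {t t' : ℕ} {p : Cmd}
  {f : Option Sym → Cmd}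

theorem run_push_main : Run (.push .main g) ⟨M, R, T, C⟩ ⟨g :: M, R, T, C⟩ 1 := .push _ _ _

theorem run_push_aux₁ : Run (.push .aux₁ g) ⟨M, R, T, C⟩ ⟨M, g :: R, T, C⟩ 1 := .push _ _ _

theorem run_push_aux₂ : Run (.push .aux₂ g) ⟨M, R, T, C⟩ ⟨M, R, g :: T, C⟩ 1 := .push _ _ _

theorem run_push_count : Run (.push .count g) ⟨M, R, T, C⟩ ⟨M, R, T, g :: C⟩ 1 := .push _ _ _

theorem run_pop_main (h : Run (f (some g)) ⟨M, R, T, C⟩ s t) :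
    Run (.pop .main f) ⟨g :: M, R, T, C⟩ s (t + 1) := .pop h

theorem run_pop_aux₁ (h : Run (f (some g)) ⟨M, R, T, C⟩ s t) :
    Run (.pop .aux₁ f) ⟨M, g :: R, T, C⟩ s (t + 1) := .pop h

theorem run_pop_aux₂ (h : Run (f (some g)) ⟨M, R, T, C⟩ s t) :
    Run (.pop .aux₂ f) ⟨M, R, g :: T, C⟩ s (t + 1) := .pop h

theorem run_loop_count (h : Run p ⟨M, R, T, C⟩ s t) (h' : Run (.loop .count p) s s' t') :
    Run (.loop .count p) ⟨M, R, T, some true :: C⟩ s' (t + t' + 1) := .loop_true rfl h h'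

theorem run_loop_count_exit :
    Run (.loop .count p) ⟨M, R, T, some false :: C⟩ ⟨M, R, T, C⟩ 1 :=
  .loop_exit (s := ⟨M, R, T, some false :: C⟩) (by simp [Store.get])

theorem run_loop_main (h : Run p ⟨M, R, T, C⟩ s t) (h' : Run (.loop .main p) s s' t') :
    Run (.loop .main p) ⟨some true :: M, R, T, C⟩ s' (t + t' + 1) := .loop_true rfl h h'

theorem run_loop_main_exit :
    Run (.loop .main p) ⟨some false :: M, R, T, C⟩ ⟨M, R, T, C⟩ 1 :=
  .loop_exit (s := ⟨some false :: M, R, T, C⟩) (by simp [Store.get])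

end Rules

theorem run_store (x y : Bool) (g : Sym) (M R T C : List Sym) :
    Run (.store x y g) ⟨M, R, T, C⟩ ⟨M, prefixIf x [g] R, prefixIf y [g] T, C⟩ 2 := by
  cases x <;> cases y
  · exact .seq (.skip _) (.skip _)
  · exact .seq (.skip _) run_push_aux₂
  · exact .seq run_push_aux₁ (.skip _)
  · exact .seq run_push_aux₁ run_push_aux₂

theorem prefixIf_prefixIf (x : Bool) (l l' r : List Sym) :
    prefixIf x l (prefixIf x l' r) = prefixIf x (l ++ l') r := by
  cases x <;> simp [prefixIf]

/-- Prefix notation delimits itself: each round consumes one `true` of the counter, an inner node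
puts back two and a leaf none. Stating the result for an arbitrary continuation of the loop lets the
two subtrees be read one after the other. A node costs six steps: loop, pop, two for storing and two
on the counter, where leaves are padded by skips. -/
theorem run_readLoop (x y : Bool) (d : Dat) : ∀ (M R T C : List Sym) (s : Store) (t : ℕ),
    Run (.loop .count (.readSymbol x y))
      ⟨M, prefixIf x d.word.reverse R, prefixIf y d.word.reverse T, C⟩ s t →
    Run (.loop .count (.readSymbol x y)) ⟨d.word ++ M, R, T, some true :: C⟩ s (t + 6 * d.size) := by
  induction d with
  | nil =>
    intro M R T C s t h
    refine (run_loop_count (run_pop_main (Run.seq (run_store x y _ _ _ _ _)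
      (.seq (.skip _) (.skip _)))) h).cast rfl ?_
    simp only [Dat.size]; omega
  | cons a b iha ihb =>
    intro M R T C s t h
    rw [Dat.word_cons, List.cons_append, List.append_assoc]
    refine (run_loop_count (run_pop_main (Run.seq (run_store x y _ _ _ _ _)
      (.seq run_push_count run_push_count))) (iha _ _ _ _ _ _ (ihb _ _ _ _ s t ?_))).cast rfl ?_
    · rw [prefixIf_prefixIf, prefixIf_prefixIf, prefixIf_prefixIf, prefixIf_prefixIf]
      rw [Dat.word_cons] at h
      simpa using h
    · simp only [Dat.size]; omega

theorem run_read (x y : Bool) (d : Dat) (M R T C : List Sym) :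
    Run (.read x y) ⟨d.word ++ M, R, T, C⟩
      ⟨M, prefixIf x d.word.reverse R, prefixIf y d.word.reverse T, C⟩ (6 * d.size + 3) :=
  (Run.seq run_push_count (.seq run_push_count (run_readLoop x y d _ _ _ _ _ _
    run_loop_count_exit))).cast rfl (by omega)

theorem run_drop (d : Dat) (M R T C : List Sym) :
    Run .drop ⟨d.word ++ M, R, T, C⟩ ⟨M, R, T, C⟩ (6 * d.size + 3) := run_read false false d M R T C

theorem run_save (d : Dat) (M R T C : List Sym) :
    Run .save ⟨d.word ++ M, R, T, C⟩ ⟨M, d.word.reverse ++ none :: R, T, C⟩ (6 * d.size + 4) :=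
  (Run.seq run_push_aux₁ (run_read true false d M _ T C)).cast rfl (by omega)

/-- Moving the reversed word reverses it once more. The counter is renewed after every bit and no
longer at the separator. A bit costs four steps; setting up and leaving the loop cost six. -/
theorem run_unload₁ (d : Dat) (M R T C : List Sym) :
    Run (.unload .aux₁) ⟨M, d.word.reverse ++ none :: R, T, C⟩ ⟨d.word ++ M, R, T, C⟩
      (4 * d.size + 6) := by
  refine (Run.seq run_push_count (.seq run_push_count (t' := 4 * d.size + 4) ?_)).cast rfl
    (by omega)
  -- The loop works for every bit string, so everything is expressed through the reversed bits, on
  -- which the induction runs.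
  rw [← d.length_bits, Dat.word, ← List.map_reverse, ← List.length_reverse]
  conv => enter [3]; rw [← List.reverse_reverse d.bits, List.map_reverse]
  induction d.bits.reverse generalizing M with
  | nil => exact (run_loop_count (run_pop_aux₁ (.skip _)) run_loop_count_exit).cast rfl rfl
  | cons b w ih =>
    refine (run_loop_count (run_pop_aux₁ (.seq run_push_main run_push_count))
      ((ih (some b :: M)).cast (s'' := ⟨((b :: w).map some).reverse ++ M, R, T, C⟩)
      (by simp) rfl)).cast rfl ?_
    simp only [List.length_cons]; omega

theorem run_unload₂ (d : Dat) (M R T C : List Sym) :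
    Run (.unload .aux₂) ⟨M, R, d.word.reverse ++ none :: T, C⟩ ⟨d.word ++ M, R, T, C⟩
      (4 * d.size + 6) := by
  refine (Run.seq run_push_count (.seq run_push_count (t' := 4 * d.size + 4) ?_)).cast rfl
    (by omega)
  rw [← d.length_bits, Dat.word, ← List.map_reverse, ← List.length_reverse]
  conv => enter [3]; rw [← List.reverse_reverse d.bits, List.map_reverse]
  induction d.bits.reverse generalizing M with
  | nil => exact (run_loop_count (run_pop_aux₂ (.skip _)) run_loop_count_exit).cast rfl rfl
  | cons b w ih =>
    refine (run_loop_count (run_pop_aux₂ (.seq run_push_main run_push_count))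
      ((ih (some b :: M)).cast (s'' := ⟨((b :: w).map some).reverse ++ M, R, T, C⟩)
      (by simp) rfl)).cast rfl ?_
    simp only [List.length_cons]; omega

theorem run_swap (a b : Dat) (M R T C : List Sym) :
    Run .swap ⟨a.word ++ (b.word ++ M), R, T, C⟩ ⟨b.word ++ (a.word ++ M), R, T, C⟩
      (10 * (a.size + b.size) + 20) :=
  (Run.seq (run_save a _ _ _ _) (.seq (.seq run_push_aux₂ (run_read false true b _ _ _ _))
    (.seq (run_unload₁ a _ _ _ _) (run_unload₂ b _ _ _ _)))).cast rfl (by omega)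

theorem run_dup (a : Dat) (M R T C : List Sym) :
    Run .dup ⟨a.word ++ M, R, T, C⟩ ⟨a.word ++ (a.word ++ M), R, T, C⟩ (14 * a.size + 17) :=
  (Run.seq run_push_aux₁ (.seq run_push_aux₂ (.seq (run_read true true a _ _ _ _)
    (.seq (run_unload₁ a _ _ _ _) (run_unload₂ a _ _ _ _))))).cast rfl (by omega)

theorem run_write (w M R T C : List Sym) :
    Run (.write w) ⟨M, R, T, C⟩ ⟨w ++ M, R, T, C⟩ (w.length + 1) := by
  induction w with
  | nil => exact .skip _
  | cons g w ih => exact (ih.seq run_push_main).cast rfl (by simp)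

/-! ### Functions computable in polynomial time -/

/-- Values that are represented by trees. -/
class Enc (T : Type) where
  enc : T → Dat

open Enc

instance : Enc Dat := ⟨id⟩

instance : Enc Bool := ⟨fun b => if b then .cons .nil .nil else .nil⟩

instance {T U : Type} [Enc T] [Enc U] : Enc (T × U) := ⟨fun p => .cons (enc p.1) (enc p.2)⟩

instance {T : Type} [Enc T] : Enc (List T) := ⟨fun l => .ofList (l.map enc)⟩

section Calculus

variable {S T U W : Type} [Enc S] [Enc T] [Enc U] [Enc W]

theorem enc_pair (a : T) (b : U) : enc (a, b) = .cons (enc a) (enc b) := rfl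

theorem enc_nil : enc ([] : List T) = .nil := rfl

theorem enc_cons (a : T) (l : List T) : enc (a :: l) = .cons (enc a) (enc l) := rfl

/-- The size of the representation of a value. -/
def sz (t : T) : ℕ := (enc t).size

@[simp] theorem sz_pair (a : T) (b : U) : sz (a, b) = 1 + (sz a + sz b) := rfl

@[simp] theorem sz_nil : sz ([] : List T) = 1 := rfl

@[simp] theorem sz_cons (a : T) (l : List T) : sz (a :: l) = 1 + (sz a + sz l) := rfl

theorem sz_bool (b : Bool) : sz b ≤ 3 := by cases b <;> simp [sz, enc, Dat.size]

theorem length_lt_sz (l : List T) : l.length < sz l := by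
  induction l with
  | nil => simp
  | cons a l ih => simp; omega

theorem sz_le_of_mem {l : List T} {a : T} (h : a ∈ l) : sz a ≤ sz l := by
  induction l with
  | nil => simp at h
  | cons b l ih =>
    rcases List.mem_cons.1 h with rfl | h
    · simp; omega
    · have := ih h
      simp; omega

theorem sz_append (l l' : List T) : sz (l ++ l') + 1 = sz l + sz l' := by
  induction l with
  | nil => simp; omega
  | cons a l ih => simp; omega

/-- The coefficients are natural numbers; this is what allows polynomial bounds to be composed. -/
theorem eval_mono (q : Polynomial ℕ) {a b : ℕ} (h : a ≤ b) : q.eval a ≤ q.eval b := by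
  induction q using Polynomial.induction_on' with
  | add p q hp hq => simp only [Polynomial.eval_add]; omega
  | monomial n c => simp only [Polynomial.eval_monomial]; gcongr

/-- `f` is computed by a program that replaces the topmost value of the main stack and leaves the
rest of the store as it was, in polynomial time. -/
def PolyTime (f : T → U) : Prop :=
  ∃ (p : Cmd) (q : Polynomial ℕ), ∀ t, sz (f t) ≤ q.eval (sz t) ∧ ∃ n ≤ q.eval (sz t),
    ∀ M A B C, Run p ⟨(enc t).word ++ M, A, B, C⟩ ⟨(enc (f t)).word ++ M, A, B, C⟩ n

/-! ### Closure properties of polynomial-time computability -/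

namespace PolyTime

theorem sz_le {f : T → U} (hf : PolyTime f) : ∃ q : Polynomial ℕ, ∀ t, sz (f t) ≤ q.eval (sz t) := by
  obtain ⟨p, q, h⟩ := hf
  exact ⟨q, fun t => (h t).1⟩

/-- Functions that agree on representations. -/
theorem of_enc_eq {f : T → U} (hf : PolyTime f) {g : S → W} (e : S → T) (he : ∀ s, enc (e s) = enc s)
    (h : ∀ s, enc (f (e s)) = enc (g s)) : PolyTime g := by
  obtain ⟨p, q, hp⟩ := hf
  refine ⟨p, q, fun s => ?_⟩
  have := hp (e s)
  unfold sz at *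
  rwa [he, h] at this

theorem id : PolyTime (fun t : T => t) :=
  ⟨.skip, Polynomial.X + 1, fun t => by
    simp only [Polynomial.eval_add, Polynomial.eval_X, Polynomial.eval_one]
    exact ⟨by omega, 1, by omega, fun _ _ _ _ => .skip _⟩⟩

theorem comp {g : U → W} {f : T → U} (hg : PolyTime g) (hf : PolyTime f) :
    PolyTime (fun t => g (f t)) := by
  obtain ⟨pg, qg, hg⟩ := hg
  obtain ⟨pf, qf, hf⟩ := hf
  refine ⟨.seq pf pg, qf + qg.comp qf, fun t => ?_⟩
  obtain ⟨hf₁, n, hn, hf₂⟩ := hf t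
  obtain ⟨hg₁, m, hm, hg₂⟩ := hg (f t)
  have := eval_mono qg hf₁
  simp only [Polynomial.eval_add, Polynomial.eval_comp]
  exact ⟨by omega, n + m, by omega, fun _ _ _ _ => .seq (hf₂ _ _ _ _) (hg₂ _ _ _ _)⟩

/-- The value of `g` is computed first from a copy of the argument, since it has to lie below that
of `f`; a final constructor bit joins the two words into one tree. -/
theorem pair {f : T → U} {g : T → W} (hf : PolyTime f) (hg : PolyTime g) :
    PolyTime (fun t => (f t, g t)) := by
  obtain ⟨pf, qf, hf⟩ := hf
  obtain ⟨pg, qg, hg⟩ := hg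
  refine ⟨.seq .dup (.seq pg (.seq .swap (.seq pf (.push .main (some true))))),
    40 * (Polynomial.X + qf + qg) + 100, fun t => ?_⟩
  obtain ⟨hf₁, n, hn, hf₂⟩ := hf t
  obtain ⟨hg₁, m, hm, hg₂⟩ := hg t
  simp only [Polynomial.eval_add, Polynomial.eval_mul, Polynomial.eval_X, Polynomial.eval_ofNat,
    sz_pair]
  refine ⟨by omega, 14 * sz t + 17 + (m + (10 * (sz (g t) + sz t) + 20 + (n + 1))), by omega,
    fun M A B C => ?_⟩
  refine .seq (run_dup _ _ _ _ _) (.seq (hg₂ _ _ _ _) (.seq (run_swap _ _ _ _ _ _)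
    (.seq (hf₂ _ _ _ _) ?_)))
  rw [enc_pair, Dat.word_cons, List.cons_append, List.append_assoc]
  exact run_push_main

theorem fst : PolyTime (fun p : T × U => p.1) := by
  refine ⟨.pop .main fun _ => .seq .swap .drop, 40 * Polynomial.X + 100, fun ⟨a, b⟩ => ?_⟩
  simp only [Polynomial.eval_add, Polynomial.eval_mul, Polynomial.eval_X, Polynomial.eval_ofNat,
    sz_pair]
  refine ⟨by omega, 10 * (sz a + sz b) + 20 + (6 * sz b + 3) + 1, by omega, fun M A B C => ?_⟩
  rw [enc_pair, Dat.word_cons, List.cons_append, List.append_assoc]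
  exact run_pop_main (.seq (run_swap _ _ _ _ _ _) (run_drop _ _ _ _ _))

theorem snd : PolyTime (fun p : T × U => p.2) := by
  refine ⟨.pop .main fun _ => .drop, 40 * Polynomial.X + 100, fun ⟨a, b⟩ => ?_⟩
  simp only [Polynomial.eval_add, Polynomial.eval_mul, Polynomial.eval_X, Polynomial.eval_ofNat,
    sz_pair]
  refine ⟨by omega, 6 * sz a + 3 + 1, by omega, fun M A B C => ?_⟩
  rw [enc_pair, Dat.word_cons, List.cons_append, List.append_assoc]
  exact run_pop_main (run_drop _ _ _ _ _)

theorem const (u : U) : PolyTime (fun _ : T => u) := by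
  refine ⟨.seq .drop (.write (enc u).word),
    6 * Polynomial.X + Polynomial.C ((enc u).word.length + sz u + 10), fun t => ?_⟩
  simp only [Polynomial.eval_add, Polynomial.eval_mul, Polynomial.eval_X, Polynomial.eval_ofNat,
    Polynomial.eval_C]
  exact ⟨by omega, 6 * sz t + 3 + ((enc u).word.length + 1), by omega,
    fun _ _ _ _ => .seq (run_drop _ _ _ _ _) (run_write _ _ _ _ _)⟩

theorem ite {c : T → Bool} {f g : T → U} (hc : PolyTime c) (hf : PolyTime f) (hg : PolyTime g) :
    PolyTime (fun t => if c t then f t else g t) := by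
  obtain ⟨pc, qc, hc⟩ := hc
  obtain ⟨pf, qf, hf⟩ := hf
  obtain ⟨pg, qg, hg⟩ := hg
  refine ⟨.seq .dup (.seq pc (.pop .main fun
    | some (some true) => .seq .drop (.seq .drop pf)
    | _ => pg)), 14 * Polynomial.X + qc + qf + qg + 100, fun t => ?_⟩
  obtain ⟨hc₁, k, hk, hc₂⟩ := hc t
  obtain ⟨hf₁, n, hn, hf₂⟩ := hf t
  obtain ⟨hg₁, m, hm, hg₂⟩ := hg t
  simp only [Polynomial.eval_add, Polynomial.eval_mul, Polynomial.eval_X, Polynomial.eval_ofNat]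
  cases h : c t
  · simp only [Bool.false_eq_true, if_false]
    refine ⟨by omega, 14 * sz t + 17 + (k + (m + 1)), by omega, fun M A B C => ?_⟩
    refine .seq (run_dup _ _ _ _ _) (.seq (hc₂ _ _ _ _) ?_)
    rw [h]
    exact run_pop_main (hg₂ _ _ _ _)
  · simp only [if_true]
    refine ⟨by omega, 14 * sz t + 17 + (k + ((6 * 1 + 3 + (6 * 1 + 3 + n)) + 1)), by omega,
      fun M A B C => ?_⟩
    refine .seq (run_dup _ _ _ _ _) (.seq (hc₂ _ _ _ _) ?_)
    rw [h]
    -- `true` is an inner node with two leaves, which remain after its first bit has been popped.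
    exact run_pop_main (.seq (run_drop .nil _ _ _ _) (.seq (run_drop .nil _ _ _ _) (hf₂ _ _ _ _)))

/-- Case distinction on a list. -/
theorem listCases {l : T → List S} {f : T → U} {g : T × S × List S → U} (hl : PolyTime l)
    (hf : PolyTime f) (hg : PolyTime g) :
    PolyTime (fun t => match l t with
      | [] => f t
      | a :: r => g (t, a, r)) := by
  obtain ⟨pl, ql, hl⟩ := hl
  obtain ⟨pf, qf, hf⟩ := hf
  obtain ⟨pg, qg, hg⟩ := hg
  refine ⟨.seq .dup (.seq pl (.pop .main fun
    | some (some true) => .seq (.push .main (some true)) (.seq .swap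
        (.seq (.push .main (some true)) pg))
    | _ => pf)), 40 * Polynomial.X + 40 * ql + qf + qg.comp (1 + (Polynomial.X + ql)) + 100,
    fun t => ?_⟩
  obtain ⟨hl₁, k, hk, hl₂⟩ := hl t
  obtain ⟨hf₁, n, hn, hf₂⟩ := hf t
  simp only [Polynomial.eval_add, Polynomial.eval_mul, Polynomial.eval_X, Polynomial.eval_ofNat,
    Polynomial.eval_comp, Polynomial.eval_one]
  cases h : l t with
  | nil =>
    refine ⟨by simp only; omega, 14 * sz t + 17 + (k + (n + 1)), by omega, fun M A B C => ?_⟩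
    refine .seq (run_dup _ _ _ _ _) (.seq (hl₂ _ _ _ _) ?_)
    rw [h]
    exact run_pop_main (hf₂ _ _ _ _)
  | cons a r =>
    obtain ⟨hg₁, m, hm, hg₂⟩ := hg (t, a, r)
    rw [h, sz_cons] at hl₁
    simp only [sz_pair] at hg₁ hm
    have := eval_mono qg (show 1 + (sz t + (1 + (sz a + sz r))) ≤ 1 + (sz t + ql.eval (sz t)) by
      omega)
    refine ⟨by simp only; omega, 14 * sz t + 17 +
      (k + ((1 + (10 * ((1 + (sz a + sz r)) + sz t) + 20 + (1 + m))) + 1)), by omega,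
      fun M A B C => ?_⟩
    refine .seq (run_dup _ _ _ _ _) (.seq (hl₂ _ _ _ _) ?_)
    rw [h, enc_cons, Dat.word_cons, List.cons_append]
    -- Head and tail lie above `t`. Restoring the constructor bit turns them into the single value
    -- `(a, r)`, which is swapped with `t`; another constructor bit forms `(t, a, r)`.
    refine run_pop_main (.seq run_push_main (.seq
      (s' := ⟨(enc t).word ++ ((enc (a, r)).word ++ M), A, B, C⟩) ?_ (.seq run_push_main ?_)))
    · have := run_swap (enc (a, r)) (enc t) M A B C
      rw [enc_pair, Dat.word_cons] at this ⊢
      exact this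
    · have := hg₂ M A B C
      rw [enc_pair, Dat.word_cons, List.cons_append, List.append_assoc] at this
      exact this

/-- Folding over a list, where the intermediate values are of polynomial size. -/
theorem foldl_aux {f : U × S → U} (hf : PolyTime f) {g : T → U × List S} (hg : PolyTime g)
    (Q : Polynomial ℕ)
    (hQ : ∀ t, ∀ l, l <+: (g t).2 → sz (l.foldl (fun u s => f (u, s)) (g t).1) ≤ Q.eval (sz t)) :
    PolyTime (fun t => (g t).2.foldl (fun u s => f (u, s)) (g t).1) := by
  obtain ⟨pf, qf, hf⟩ := hf
  obtain ⟨pg, qg, hg⟩ := hg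
  -- Between rounds the remaining list lies above the accumulator, and its constructor bit serves as
  -- the loop condition. A round rearranges head, tail and accumulator into the pair `(u, s)` above
  -- the tail, applies `f`, and brings the tail back to the top.
  let body : Cmd := .seq .save (.seq .swap (.seq (.unload .aux₁) (.seq .swap
    (.seq (.push .main (some true)) (.seq pf .swap)))))
  -- `N` bounds the remaining list and `B` all intermediate accumulators, which makes the bound on
  -- the cost of a round uniform.
  have key : ∀ (N B : ℕ) (l : List S) (u : U), sz l ≤ N →
      (∀ l', l' <+: l → sz (l'.foldl (fun u s => f (u, s)) u) ≤ B) →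
      ∃ n ≤ l.length * (60 * (N + B) + 100 + qf.eval (1 + (B + N))) + 1, ∀ M A B C,
        Run (.loop .main body) ⟨(enc l).word ++ ((enc u).word ++ M), A, B, C⟩
          ⟨(enc (l.foldl (fun u s => f (u, s)) u)).word ++ M, A, B, C⟩ n := by
    intro N B l
    induction l with
    | nil => exact fun u _ _ => ⟨1, by simp, fun M A B C => run_loop_main_exit⟩
    | cons s l ih =>
      intro u hN hB
      obtain ⟨hf₁, m, hm, hf₂⟩ := hf (u, s)
      have hu := hB [] (by simp)
      have hu' := hB [s] (by simp)
      simp only [List.foldl_nil, List.foldl_cons] at hu hu'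
      simp only [sz_cons, sz_pair] at hN hf₁ hm
      obtain ⟨n, hn, hr⟩ := ih (f (u, s)) (by omega) fun l' hl' =>
        hB (s :: l') (by simpa using hl')
      have := eval_mono qf (show 1 + (sz u + sz s) ≤ 1 + (B + N) by omega)
      refine ⟨(6 * sz s + 4 + (10 * (sz l + sz u) + 20 + ((4 * sz s + 6) +
        (10 * (sz s + sz u) + 20 + (1 + (m + (10 * (sz (f (u, s)) + sz l) + 20))))))) + n + 1,
        ?_, fun M A B C => ?_⟩
      · rw [List.length_cons, Nat.add_mul, Nat.one_mul]; omega
      · rw [enc_cons, Dat.word_cons, List.cons_append, List.append_assoc]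
        refine run_loop_main (.seq (run_save _ _ _ _ _) (.seq (run_swap _ _ _ _ _ _)
          (.seq (run_unload₁ _ _ _ _ _) (.seq (run_swap _ _ _ _ _ _) (.seq run_push_main
          (.seq ?_ (run_swap (enc (f (u, s))) (enc l) M A B C))))))) (hr M A B C)
        have := hf₂ ((enc l).word ++ M) A B C
        rw [enc_pair, Dat.word_cons, List.cons_append, List.append_assoc] at this
        exact this
  refine ⟨.seq pg (.pop .main fun _ => .seq .swap (.loop .main body)),
    Q + qg * (60 * (qg + Q) + 100 + qf.comp (1 + (Q + qg))) + 20 * qg + 100, fun t => ?_⟩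
  obtain ⟨hg₁, m, hm, hg₂⟩ := hg t
  have hQt := hQ t
  beta_reduce
  generalize g t = c at *
  obtain ⟨u, l⟩ := c
  simp only at hQt ⊢
  rw [sz_pair] at hg₁
  obtain ⟨n, hn, hr⟩ := key (qg.eval (sz t)) (Q.eval (sz t)) l u (by omega) hQt
  have hl : l.length ≤ qg.eval (sz t) := by have := length_lt_sz l; omega
  have := Nat.mul_le_mul_right (60 * (qg.eval (sz t) + Q.eval (sz t)) + 100 +
    qf.eval (1 + (Q.eval (sz t) + qg.eval (sz t)))) hl
  simp only [Polynomial.eval_add, Polynomial.eval_mul, Polynomial.eval_ofNat,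
    Polynomial.eval_comp, Polynomial.eval_one]
  refine ⟨?_, m + ((10 * (sz u + sz l) + 20 + n) + 1), ?_, fun M A B C => ?_⟩
  · have := hQt l (List.prefix_refl l)
    omega
  · omega
  · refine .seq (hg₂ M A B C) ?_
    rw [enc_pair, Dat.word_cons, List.cons_append, List.append_assoc]
    exact run_pop_main (.seq (run_swap _ _ _ _ _ _) (hr _ _ _ _))

end PolyTime

end Calculus

/-! ### Lists and predicates -/

/-- A proposition is represented by its truth value. -/
noncomputable instance : Enc Prop := ⟨fun p => enc (@decide p (Classical.propDecidable p))⟩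

section Calculus

variable {S T U V W : Type} [Enc S] [Enc T] [Enc U] [Enc V] [Enc W]

attribute [fun_prop] PolyTime PolyTime.id PolyTime.comp PolyTime.const PolyTime.pair

/-- Any two decidability instances agree, so the classical one in the representation is harmless. -/
theorem enc_prop (p : Prop) [h : Decidable p] : enc p = enc (decide p) := by
  rw [Subsingleton.elim h (Classical.propDecidable p)]; rfl

theorem sz_prop (p : Prop) : sz p ≤ 3 := sz_bool _

namespace PolyTime

@[fun_prop]
theorem fst' {f : T → U × W} (hf : PolyTime f) : PolyTime (fun t => (f t).1) := fst.comp hf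

@[fun_prop]
theorem snd' {f : T → U × W} (hf : PolyTime f) : PolyTime (fun t => (f t).2) := snd.comp hf

@[fun_prop]
theorem cons {a : T → S} {l : T → List S} (ha : PolyTime a) (hl : PolyTime l) :
    PolyTime (fun t => a t :: l t) :=
  (ha.pair hl).of_enc_eq (fun t => t) (fun _ => rfl) (fun _ => rfl)

@[fun_prop]
theorem eq_true {f : T → Bool} (hf : PolyTime f) : PolyTime (fun t => f t = true) :=
  hf.of_enc_eq (fun t => t) (fun _ => rfl) fun t => by
    rw [enc_prop]; simp

@[fun_prop]
theorem decide {P : T → Prop} [∀ t, Decidable (P t)] (hP : PolyTime P) :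
    PolyTime (fun t => decide (P t)) :=
  hP.of_enc_eq (fun t => t) (fun _ => rfl) fun t =>
    enc_prop (P t)

theorem congr {f g : T → U} (hf : PolyTime f) (h : ∀ t, f t = g t) : PolyTime g := by
  rwa [← funext h]

theorem congr_iff {P Q : T → Prop} (hP : PolyTime P) (h : ∀ t, P t ↔ Q t) : PolyTime Q :=
  hP.congr fun t => propext (h t)

@[fun_prop]
theorem ite_prop {P : T → Prop} [∀ t, Decidable (P t)] {f g : T → U} (hP : PolyTime P)
    (hf : PolyTime f) (hg : PolyTime g) : PolyTime (fun t => if P t then f t else g t) :=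
  (hP.decide.ite hf hg).congr fun t => by simp

@[fun_prop]
theorem not {P : T → Prop} (hP : PolyTime P) : PolyTime (fun t => ¬ P t) := by
  classical
  exact (hP.ite_prop (const False) (const True)).congr fun t => by by_cases h : P t <;> simp [h]

@[fun_prop]
theorem and {P Q : T → Prop} (hP : PolyTime P) (hQ : PolyTime Q) :
    PolyTime (fun t => P t ∧ Q t) := by
  classical
  exact (hP.ite_prop hQ (const False)).congr fun t => by by_cases h : P t <;> simp [h]

@[fun_prop]
theorem or {P Q : T → Prop} (hP : PolyTime P) (hQ : PolyTime Q) :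
    PolyTime (fun t => P t ∨ Q t) := by
  classical
  exact (hP.ite_prop (const True) hQ).congr fun t => by by_cases h : P t <;> simp [h]

theorem imp {P Q : T → Prop} (hP : PolyTime P) (hQ : PolyTime Q) :
    PolyTime (fun t => P t → Q t) :=
  (hP.not.or hQ).congr_iff fun _ => imp_iff_not_or.symm

@[fun_prop]
theorem iff {P Q : T → Prop} (hP : PolyTime P) (hQ : PolyTime Q) :
    PolyTime (fun t => P t ↔ Q t) :=
  ((hP.imp hQ).and (hQ.imp hP)).congr_iff fun _ => iff_iff_implies_and_implies.symm

/-- Folding over a list, where each step adds at most a polynomial to the size. -/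
theorem foldl {f : T → U → S → U} {b : T → U} {l : T → List S}
    (hf : PolyTime fun p : T × U × S => f p.1 p.2.1 p.2.2) (hb : PolyTime b) (hl : PolyTime l)
    (Q : Polynomial ℕ) (hQ : ∀ t u s, s ∈ l t → sz (f t u s) ≤ sz u + Q.eval (sz t)) :
    PolyTime (fun t => (l t).foldl (f t) (b t)) := by
  -- The step function depends on `t`, so `t` is carried along in the accumulator.
  have e : ∀ (t : T) (l : List S) (u : U),
      l.foldl (fun (c : T × U) s => (c.1, f c.1 c.2 s)) (t, u) = (t, l.foldl (f t) u) := by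
    intro t l
    induction l with
    | nil => exact fun u => rfl
    | cons s l ih => exact fun u => ih _
  have bound : ∀ (t : T) (l' : List S) (u : U), (∀ s ∈ l', s ∈ l t) →
      sz (l'.foldl (f t) u) ≤ sz u + l'.length * Q.eval (sz t) := by
    intro t l'
    induction l' with
    | nil => intro u _; simp
    | cons s l' ih =>
      intro u h
      have h₁ := ih (f t u s) fun s' hs' => h s' (by simp [hs'])
      have h₂ := hQ t u s (h s (by simp))
      rw [List.foldl_cons, List.length_cons, Nat.add_mul, Nat.one_mul]
      omega
  obtain ⟨qb, hqb⟩ := hb.sz_le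
  obtain ⟨ql, hql⟩ := hl.sz_le
  have key : PolyTime (fun t => ((t, b t), l t).2.foldl
      (fun u s => (fun c : (T × U) × S => (c.1.1, f c.1.1 c.1.2 c.2)) (u, s)) ((t, b t), l t).1) := by
    refine foldl_aux (T := T) (g := fun t => ((t, b t), l t))
      (f := fun c : (T × U) × S => (c.1.1, f c.1.1 c.1.2 c.2)) ?_ (by fun_prop)
      (1 + (Polynomial.X + (qb + ql * Q))) fun t l' hl' => ?_
    · exact fst.fst'.pair (hf.comp (f := fun c : (T × U) × S => (c.1.1, c.1.2, c.2)) (by fun_prop))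
    · simp only [e, sz_pair, Polynomial.eval_add, Polynomial.eval_mul, Polynomial.eval_X,
        Polynomial.eval_one]
      have h₁ := bound t l' (b t) fun s hs => hl'.subset hs
      have h₂ : l'.length ≤ ql.eval (sz t) :=
        hl'.length_le.trans ((length_lt_sz _).le.trans (hql t))
      have h₃ := Nat.mul_le_mul_right (Q.eval (sz t)) h₂
      have := hqb t
      omega
  exact key.snd'.congr fun t => by simp only [e]

@[fun_prop]
theorem reverse {l : T → List S} (hl : PolyTime l) : PolyTime (fun t => (l t).reverse) := by
  obtain ⟨ql, hql⟩ := hl.sz_le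
  refine (foldl (f := fun _ acc s => s :: acc) (b := fun _ => []) (by fun_prop) (by fun_prop) hl
    (1 + ql) fun t u s hs => ?_).congr fun t => List.foldl_flip_cons_eq_append'.trans (by simp)
  have := (sz_le_of_mem hs).trans (hql t)
  simp only [sz_cons, Polynomial.eval_add, Polynomial.eval_one]
  omega

theorem foldr {f : T → S → U → U} {b : T → U} {l : T → List S}
    (hf : PolyTime fun p : T × S × U => f p.1 p.2.1 p.2.2) (hb : PolyTime b) (hl : PolyTime l)
    (Q : Polynomial ℕ) (hQ : ∀ t s u, s ∈ l t → sz (f t s u) ≤ sz u + Q.eval (sz t)) :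
    PolyTime (fun t => (l t).foldr (f t) (b t)) :=
  (foldl (f := fun t u s => f t s u) (l := fun t => (l t).reverse)
    (hf.comp (f := fun p : T × U × S => (p.1, p.2.2, p.2.1)) (by fun_prop)) hb hl.reverse Q
    fun t u s hs => hQ t s u (by simpa using hs)).congr fun t => by simp

@[fun_prop]
theorem append {l l' : T → List S} (hl : PolyTime l) (hl' : PolyTime l') :
    PolyTime (fun t => l t ++ l' t) := by
  obtain ⟨ql, hql⟩ := hl.sz_le
  refine (foldr (f := fun _ s acc => s :: acc) (by fun_prop) hl' hl
    (1 + ql) fun t s u hs => ?_).congr fun t => by simp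
  have := (sz_le_of_mem hs).trans (hql t)
  simp only [sz_cons, Polynomial.eval_add, Polynomial.eval_one]
  omega

theorem flatMap {g : T → S → List U} {l : T → List S}
    (hg : PolyTime fun p : T × S => g p.1 p.2) (hl : PolyTime l) :
    PolyTime (fun t => (l t).flatMap (g t)) := by
  obtain ⟨ql, hql⟩ := hl.sz_le
  obtain ⟨qg, hqg⟩ := hg.sz_le
  refine (foldr (f := fun t s acc => g t s ++ acc) (b := fun _ => []) ?_ (by fun_prop) hl
    (qg.comp (1 + (Polynomial.X + ql))) fun t s u hs => ?_).congr fun t => ?_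
  · exact (hg.comp (f := fun p : T × S × List U => (p.1, p.2.1)) (by fun_prop)).append (by fun_prop)
  · have h₁ := (sz_le_of_mem hs).trans (hql t)
    have h₂ := hqg (t, s)
    rw [sz_pair] at h₂
    have h₃ := eval_mono qg (show 1 + (sz t + sz s) ≤ 1 + (sz t + ql.eval (sz t)) by omega)
    have h₄ := sz_append (g t s) u
    simp only [Polynomial.eval_add, Polynomial.eval_one, Polynomial.eval_comp, Polynomial.eval_X]
    have h₅ : sz (g t s) ≤ Polynomial.eval (1 + (sz t + sz s)) qg := h₂
    omega
  · generalize l t = l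
    induction l with
    | nil => rfl
    | cons s l ih => simp [ih]

theorem map {g : T → S → U} {l : T → List S} (hg : PolyTime fun p : T × S => g p.1 p.2)
    (hl : PolyTime l) : PolyTime (fun t => (l t).map (g t)) :=
  (flatMap (g := fun t s => [g t s]) (hg.cons (const [])) hl).congr fun t => by
    rw [List.map_eq_flatMap]

theorem filter {P : T → S → Bool} {l : T → List S} (hP : PolyTime fun p : T × S => P p.1 p.2)
    (hl : PolyTime l) : PolyTime (fun t => (l t).filter (P t)) :=
  (flatMap (g := fun t s => if P t s then [s] else []) (hP.ite (by fun_prop) (const [])) hl).congr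
    fun t => by
      generalize l t = l
      induction l with
      | nil => rfl
      | cons s l ih => cases h : P t s <;> simp [ih, h]

@[fun_prop]
theorem flatten {l : T → List (List S)} (hl : PolyTime l) : PolyTime (fun t => (l t).flatten) :=
  (flatMap (g := fun _ s => s) (by fun_prop) hl).congr fun t => by
    rw [List.flatMap_id' ]

theorem exists_mem {P : T → S → Prop} {l : T → List S} (hP : PolyTime fun p : T × S => P p.1 p.2)
    (hl : PolyTime l) : PolyTime (fun t => ∃ s ∈ l t, P t s) := by
  refine (foldr (f := fun t s (p : Prop) => P t s ∨ p) (b := fun _ => False) ?_ (by fun_prop) hl 3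
    fun t s u hs => ?_).congr_iff fun t => ?_
  · exact (hP.comp (f := fun p : T × S × Prop => (p.1, p.2.1)) (by fun_prop)).or (by fun_prop)
  · have := sz_prop (P t s ∨ u)
    simp only [Polynomial.eval_ofNat]
    omega
  · generalize l t = l
    induction l with
    | nil => simp
    | cons s l ih => simp [ih]

theorem forall_mem {P : T → S → Prop} {l : T → List S} (hP : PolyTime fun p : T × S => P p.1 p.2)
    (hl : PolyTime l) : PolyTime (fun t => ∀ s ∈ l t, P t s) :=
  (exists_mem (P := fun t s => ¬ P t s) hP.not hl).not.congr_iff fun t => by simp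

theorem pairwise {P : T → S → S → Prop} {l : T → List S}
    (hP : PolyTime fun p : T × S × S => P p.1 p.2.1 p.2.2) (hl : PolyTime l) :
    PolyTime (fun t => (l t).Pairwise (P t)) := by
  obtain ⟨ql, hql⟩ := hl.sz_le
  -- Besides the truth value, the accumulator keeps the part of the list already traversed, with
  -- which the next entry is compared.
  have key : PolyTime (fun t => (l t).foldr (fun s (c : List S × Prop) =>
      (s :: c.1, (∀ s' ∈ c.1, P t s s') ∧ c.2)) ([], True)) := by
    refine foldr (f := fun t s (c : List S × Prop) => (s :: c.1, (∀ s' ∈ c.1, P t s s') ∧ c.2))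
      (b := fun _ => ([], True)) ?_ (by fun_prop) hl (4 + ql) fun t s u hs => ?_
    · refine PolyTime.pair (by fun_prop) (PolyTime.and ?_ (by fun_prop))
      exact forall_mem (P := fun (p : T × S × List S × Prop) s' => P p.1 p.2.1 s')
        (hP.comp (f := fun p : (T × S × List S × Prop) × S => (p.1.1, p.1.2.1, p.2)) (by fun_prop))
        (by fun_prop)
    · have := (sz_le_of_mem hs).trans (hql t)
      have h := sz_prop ((∀ s' ∈ u.1, P t s s') ∧ u.2)
      have e : sz u = 1 + (sz u.1 + sz u.2) := rfl
      simp only [sz_cons, sz_pair, Polynomial.eval_add, Polynomial.eval_ofNat]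
      omega
  refine key.snd'.congr_iff fun t => ?_
  have : ∀ l : List S, l.foldr (fun s (c : List S × Prop) =>
      (s :: c.1, (∀ s' ∈ c.1, P t s s') ∧ c.2)) ([], True) = (l, l.Pairwise (P t)) := by
    intro l
    induction l with
    | nil => simp
    | cons s l ih => simp [ih]
  rw [this]

@[fun_prop]
theorem tail {l : T → List S} (hl : PolyTime l) : PolyTime (fun t => (l t).tail) :=
  (listCases (f := fun _ => []) (g := fun p : T × S × List S => p.2.2) hl (by fun_prop)
    (by fun_prop)).congr fun t => by cases l t <;> rfl

@[fun_prop]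
theorem headD {l : T → List S} {a : T → S} (hl : PolyTime l) (ha : PolyTime a) :
    PolyTime (fun t => (l t).headD (a t)) :=
  (listCases (f := a) (g := fun p : T × S × List S => p.2.1) hl (by fun_prop)
    (by fun_prop)).congr fun t => by cases l t <;> rfl

@[fun_prop]
theorem eq_nil {l : T → List S} (hl : PolyTime l) : PolyTime (fun t => l t = []) :=
  (listCases (f := fun _ => True) (g := fun _ : T × S × List S => False) hl (by fun_prop)
    (by fun_prop)).congr fun t => by cases l t <;> simp

/-- Here `n` is fixed in advance, so the program may depend on it and simply takes `n` tails. -/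
theorem length_eq {l : T → List S} (hl : PolyTime l) (n : ℕ) :
    PolyTime (fun t => (l t).length = n) := by
  induction n generalizing l with
  | zero => exact hl.eq_nil.congr_iff fun t => List.length_eq_zero_iff.symm
  | succ n ih =>
    exact (hl.eq_nil.not.and (ih hl.tail)).congr_iff fun t => by cases l t <;> simp

end PolyTime

/-! ### Equality -/

/-- Equality can be decided in polynomial time. -/
class PolyEq (T : Type) [Enc T] : Prop where
  eq : PolyTime (fun p : T × T => p.1 = p.2)

@[fun_prop]
theorem PolyTime.eq [PolyEq U] {f g : T → U} (hf : PolyTime f) (hg : PolyTime g) :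
    PolyTime (fun t => f t = g t) :=
  PolyEq.eq.comp (hf.pair hg)

@[fun_prop]
theorem PolyTime.mem [PolyEq U] {f : T → U} {l : T → List U} (hf : PolyTime f) (hl : PolyTime l) :
    PolyTime (fun t => f t ∈ l t) :=
  (exists_mem (P := fun t u => f t = u) (by fun_prop) hl).congr_iff fun t => by simp

instance : PolyEq Bool where
  eq := (PolyTime.iff (PolyTime.fst (T := Bool) (U := Bool)).eq_true PolyTime.snd.eq_true).congr_iff
    fun _ => Bool.eq_iff_iff.symm

instance [PolyEq T] [PolyEq U] : PolyEq (T × U) where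
  eq := (show PolyTime (fun p : (T × U) × (T × U) => p.1.1 = p.2.1 ∧ p.1.2 = p.2.2) by
    fun_prop).congr_iff fun _ => Prod.ext_iff.symm

/-- One step of the comparison of two lists. -/
def eqStep (c : Prop × List S) (s : S) : Prop × List S :=
  match c.2 with
  | [] => (False, [])
  | a :: r => (c.1 ∧ s = a, r)

/-- The second list is consumed while the first is traversed: they are equal if no comparison fails,
the second is not exhausted early, and nothing of it is left. -/
theorem foldl_eqStep {S : Type} (l : List S) : ∀ (P : Prop) (r : List S),
    (l.foldl eqStep (P, r)).1 ∧ (l.foldl eqStep (P, r)).2 = [] ↔ P ∧ l = r := by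
  induction l with
  | nil => intro P r; simp [eq_comm]
  | cons s l ih =>
    intro P r
    rw [List.foldl_cons]
    cases r with
    | nil => rw [eqStep, ih]; simp
    | cons a r => rw [eqStep, ih]; simp [and_assoc]

theorem polyTime_eqStep [PolyEq S] : PolyTime (fun p : (Prop × List S) × S => eqStep p.1 p.2) :=
  (PolyTime.listCases (l := fun p : (Prop × List S) × S => p.1.2) (f := fun _ => (False, []))
    (g := fun p : ((Prop × List S) × S) × S × List S => (p.1.1.1 ∧ p.1.2 = p.2.1, p.2.2))
    (by fun_prop) (by fun_prop) (by fun_prop)).congr fun p => by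
      obtain ⟨⟨c, _ | ⟨a, r⟩⟩, s⟩ := p <;> rfl

instance [PolyEq S] : PolyEq (List S) where
  eq := by
    have h : PolyTime (fun p : List S × List S => p.1.foldl eqStep (True, p.2)) := by
      refine PolyTime.foldl (f := fun _ c s => eqStep c s)
        (b := fun p : List S × List S => (True, p.2))
        (polyTime_eqStep.comp PolyTime.snd) (by fun_prop) (by fun_prop) 4 fun t u s _ => ?_
      obtain ⟨P, r⟩ := u
      cases r with
      | nil =>
        have := sz_prop False
        simp only [eqStep, sz_pair, sz_nil, Polynomial.eval_ofNat]
        omega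
      | cons a r =>
        have := sz_prop (P ∧ s = a)
        simp only [eqStep, sz_pair, sz_cons, Polynomial.eval_ofNat]
        omega
    exact (h.fst'.and h.snd'.eq_nil).congr_iff fun p => by rw [foldl_eqStep]; simp

/-! ### Trees as lists and pairs -/

namespace Dat

/-- The list of which a tree is the representation. -/
def toList : Dat → List Dat
  | nil => []
  | cons a b => a :: b.toList

theorem ofList_toList (d : Dat) : ofList d.toList = d := by
  induction d with
  | nil => rfl
  | cons a b _ ih => simp [toList, ofList, ih]

theorem enc_toList (d : Dat) : enc d.toList = d := by
  change ofList (d.toList.map _root_.id) = d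
  rw [List.map_id, ofList_toList]

/-- The left subtree. -/
def left (d : Dat) : Dat := d.toList.headD .nil

/-- The right subtree. -/
def right : Dat → Dat
  | nil => nil
  | cons _ b => b

theorem right_eq (d : Dat) : d.right = enc d.toList.tail := by
  cases d with
  | nil => rfl
  | cons a b => exact (enc_toList b).symm

/-- The additional one is needed for a leaf, both of whose subtrees are leaves by convention. -/
theorem sz_left_add_sz_right (d : Dat) : sz d.left + sz d.right ≤ sz d + 1 := by
  cases d <;> simp [left, right, sz, enc, size, toList]; omega

end Dat

namespace PolyTime

@[fun_prop]
theorem enc {f : T → U} (hf : PolyTime f) : PolyTime (fun t => enc (f t)) :=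
  hf.of_enc_eq (fun t => t) (fun _ => rfl) (fun _ => rfl)

@[fun_prop]
theorem toList {f : T → Dat} (hf : PolyTime f) : PolyTime (fun t => (f t).toList) :=
  hf.of_enc_eq (fun t => t) (fun _ => rfl) (fun t => (Dat.enc_toList (f t)).symm)

@[fun_prop]
theorem left {f : T → Dat} (hf : PolyTime f) : PolyTime (fun t => (f t).left) := by
  unfold Dat.left; fun_prop

@[fun_prop]
theorem right {f : T → Dat} (hf : PolyTime f) : PolyTime (fun t => (f t).right) := by
  simp only [Dat.right_eq]; fun_prop

@[fun_prop]
theorem datCons {f g : T → Dat} (hf : PolyTime f) (hg : PolyTime g) :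
    PolyTime (fun t => Dat.cons (f t) (g t)) :=
  (hf.pair hg).of_enc_eq (fun t => t) (fun _ => rfl) (fun _ => rfl)

/-- As `d` is fixed, its shape can be built into the program; this suffices for case distinctions
over finite types. -/
theorem dat_eq {f : T → Dat} (hf : PolyTime f) (d : Dat) : PolyTime (fun t => f t = d) := by
  induction d generalizing f with
  | nil => exact hf.toList.eq_nil.congr_iff fun t => by cases f t <;> simp [Dat.toList]
  | cons a b iha ihb =>
    refine (hf.toList.eq_nil.not.and ((iha hf.left).and (ihb hf.right))).congr_iff fun t => ?_
    cases f t <;> simp [Dat.toList, Dat.left, Dat.right]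

/-! ### Finite types -/

/-- Case distinction on the elements of a finite type. -/
theorem finite_cases [Finite S] (hS : Function.Injective (Enc.enc : S → Dat)) {f : S → T → U}
    (hf : ∀ s, PolyTime (f s)) : PolyTime (fun p : S × T => f p.1 p.2) := by
  classical
  have := Fintype.ofFinite S
  -- A chain of comparisons with the elements of `l`; the last element needs no test and acts as the
  -- default, hence `l` must be nonempty.
  have key : ∀ l : List S, l ≠ [] → ∃ g : S × T → U, PolyTime g ∧ ∀ s ∈ l, ∀ t, g (s, t) = f s t := by
    intro l
    induction l with
    | nil => simp
    | cons a l ih =>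
      intro _
      by_cases hl : l = []
      · exact ⟨fun p => f a p.2, (hf a).comp (by fun_prop), by simp [hl]⟩
      · obtain ⟨g, hg, h⟩ := ih hl
        refine ⟨fun p => if Enc.enc p.1 = Enc.enc a then f a p.2 else g p,
          (dat_eq (by fun_prop) _).ite_prop ((hf a).comp (by fun_prop)) hg, fun s hs t => ?_⟩
        by_cases e : s = a
        · simp [e]
        · refine (if_neg fun e' => e (hS e')).trans ?_
          exact h s (by simpa [e] using hs) t
  rcases isEmpty_or_nonempty S with h | h
  · exact ⟨.skip, 0, fun p => (IsEmpty.false p.1).elim⟩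
  · obtain ⟨g, hg, e⟩ := key Finset.univ.toList (by simp [Finset.univ_nonempty.ne_empty])
    exact hg.congr fun p => e p.1 (by simp) p.2

end PolyTime

/-- A natural number in unary as a tree. -/
def Dat.ofNat : ℕ → Dat
  | 0 => .nil
  | n + 1 => .cons .nil (Dat.ofNat n)

theorem Dat.ofNat_injective : Function.Injective Dat.ofNat := by
  intro m
  induction m with
  | zero => rintro (_ | n) h <;> simp_all [Dat.ofNat]
  | succ m ih =>
    rintro (_ | n) h
    · simp [Dat.ofNat] at h
    · simp only [Dat.ofNat, Dat.cons.injEq, true_and] at h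
      rw [ih h]

/-- The elements of a finite type, represented by numbers. -/
noncomputable def encFinite (A : Type) [Fintype A] (a : A) : Dat :=
  .ofNat (Fintype.equivFin A a)

theorem encFinite_injective (A : Type) [Fintype A] : Function.Injective (encFinite A) := fun _ _ h =>
  (Fintype.equivFin A).injective (Fin.ext (Dat.ofNat_injective h))

noncomputable instance : Enc Γ' := ⟨encFinite Γ'⟩

theorem PolyEq.of_finite [Finite S] (hS : Function.Injective (enc : S → Dat)) : PolyEq S where
  eq := PolyTime.finite_cases hS (f := fun a b => a = b) fun a =>
    (PolyTime.dat_eq (f := fun b : S => enc b) (by fun_prop) (enc a)).congr_iff fun b =>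
      ⟨fun h => (hS h).symm, fun h => h ▸ rfl⟩

instance : PolyEq Γ' := .of_finite (encFinite_injective Γ')

@[fun_prop]
theorem PolyTime.bit {f : T → Bool} (hf : PolyTime f) : PolyTime (fun t => Γ'.bit (f t)) :=
  (hf.ite (const (Γ'.bit true)) (const (Γ'.bit false))).congr fun t => by cases f t <;> rfl

/-! ### Numbers in binary -/

/-- The digits rather than a unary tree, because the bounds `κ` and `Γ` may be exponential in the
length of the input. -/
instance : Enc ℕ := ⟨fun n => enc (encodeNat n)⟩

@[fun_prop]
theorem PolyTime.encodeNat {f : T → ℕ} (hf : PolyTime f) : PolyTime (fun t => encodeNat (f t)) :=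
  hf.of_enc_eq (fun t => t) (fun _ => rfl) (fun _ => rfl)

instance : PolyEq ℕ where
  eq := (show PolyTime (fun p : ℕ × ℕ => encodeNat p.1 = encodeNat p.2) by fun_prop).congr_iff
    fun _ => encodingNatBool.encode_injective.eq_iff

/-- The least significant digit comes first, and a list that does not end with the digit one is
decoded as if such a digit followed. -/
theorem encodePosNum_decodePosNum (l : List Bool) : encodePosNum (decodePosNum l) =
    if l.getLast? = some true then l else l ++ [true] := by
  induction l with
  | nil => rfl
  | cons b l ih =>
    cases l with
    | nil => cases b <;> simp [decodePosNum, encodePosNum]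
    | cons c l =>
      rw [List.getLast?_cons_cons]
      have e : encodePosNum (decodePosNum (b :: c :: l)) = b :: encodePosNum (decodePosNum (c :: l)) := by
        cases b <;> simp [decodePosNum, encodePosNum]
      rw [e, ih]
      split_ifs <;> rfl

/-- On representations, decoding appends at most one digit, so it is computable in polynomial time
even on improper digit lists. -/
theorem encodeNat_decodeNat (l : List Bool) : encodeNat (decodeNat l) =
    if l = [] ∨ l.reverse.headD false = true then l else l ++ [true] := by
  have e : encodeNat (decodeNat l) = encodeNum (decodeNum l) := by
    unfold encodeNat decodeNat
    rw [Num.of_to_nat]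
  rw [e, decodeNum]
  by_cases h : l = []
  · simp [h, encodeNum]
  · rw [if_neg h]
    have h₁ : encodeNum (decodePosNum l : Num) = encodePosNum (decodePosNum l) := by
      rw [PosNum.cast_to_num]; rfl
    rw [h₁, encodePosNum_decodePosNum]
    have h₂ : l.getLast? = some true ↔ l = [] ∨ l.reverse.headD false = true := by
      rw [← List.head?_reverse]
      cases hr : l.reverse with
      | nil => simp_all
      | cons b r => simp [h]
    simp only [h₂]

@[fun_prop]
theorem PolyTime.decodeNat {f : T → List Bool} (hf : PolyTime f) :
    PolyTime (fun t => decodeNat (f t)) :=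
  (show PolyTime (fun t => if f t = [] ∨ (f t).reverse.headD false = true then f t
    else f t ++ [true]) by fun_prop).of_enc_eq (fun t => t) (fun _ => rfl) fun t => by
      change _ = Enc.enc (Computability.encodeNat (Computability.decodeNat (f t)))
      rw [encodeNat_decodeNat]

/-- The number with the given binary digits, the least significant first. -/
def binVal (l : List Bool) : ℕ := l.foldr (fun b n => b.toNat + 2 * n) 0

theorem binVal_encodeNat (n : ℕ) : binVal (encodeNat n) = n := by
  have h : ∀ p : PosNum, binVal (encodePosNum p) = p := by
    intro p
    induction p with
    | one => rfl
    | bit0 p ih =>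
      rw [encodePosNum, binVal, List.foldr_cons, ← binVal, ih, PosNum.cast_bit0]; simp; omega
    | bit1 p ih =>
      rw [encodePosNum, binVal, List.foldr_cons, ← binVal, ih, PosNum.cast_bit1]; simp; omega
  conv_rhs => rw [← Num.to_of_nat n]
  unfold encodeNat
  cases (n : Num) with
  | zero => rfl
  | pos p => exact h p

/-- One step of the selection of every other entry of a list. -/
def halveStep {S : Type} (c : Bool × List S) (s : S) : Bool × List S :=
  if c.1 then (false, c.2) else (true, s :: c.2)

/-- Every other entry of a list, beginning with the first, in the reverse order. -/
def halve {S : Type} (l : List S) : List S := (l.foldl halveStep (false, [])).2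

theorem length_halve {S : Type} (l : List S) : (halve l).length = (l.length + 1) / 2 := by
  have h : ∀ l r : List S,
      (l.foldl halveStep (false, r)).2.length = r.length + (l.length + 1) / 2 ∧
      (l.foldl halveStep (true, r)).2.length = r.length + l.length / 2 := by
    intro l
    induction l with
    | nil => simp
    | cons s l ih =>
      intro r
      have h₁ := (ih (s :: r)).2
      have h₂ := (ih r).1
      simp only [List.length_cons] at h₁ ⊢
      constructor
      · exact h₁.trans (by omega)
      · exact h₂.trans (by omega)
  simpa [halve] using (h l []).1

theorem sz_halve_le (l : List S) : sz (halve l) ≤ sz l := by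
  have h : ∀ (l : List S) (b : Bool) (r : List S),
      sz (l.foldl halveStep (b, r)).2 + 1 ≤ sz r + sz l := by
    intro l
    induction l with
    | nil => simp
    | cons s l ih =>
      intro b r
      cases b
      · have := ih true (s :: r)
        simp only [sz_cons] at this ⊢
        exact this.trans (by omega)
      · have := ih false r
        simp only [sz_cons]
        exact this.trans (by omega)
  have := h l false []
  simp only [sz_nil] at this
  unfold halve
  omega

namespace PolyTime

@[fun_prop]
theorem halve {l : T → List S} (hl : PolyTime l) : PolyTime (fun t => halve (l t)) := by
  obtain ⟨ql, hql⟩ := hl.sz_le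
  refine PolyTime.snd' (f := fun t => (l t).foldl halveStep (false, [])) ?_
  refine foldl (f := fun _ (c : Bool × List S) s => halveStep c s)
    (b := fun _ => (false, [])) ?_ (by fun_prop) hl (4 + ql) fun t u s hs => ?_
  · exact ite (c := fun p : T × (Bool × List S) × S => p.2.1.1) (by fun_prop) (by fun_prop)
      (by fun_prop)
  · have h₁ := (sz_le_of_mem hs).trans (hql t)
    obtain ⟨b, r⟩ := u
    have h₂ := sz_bool false
    have h₃ := sz_bool true
    simp only [Polynomial.eval_add, Polynomial.eval_ofNat]
    cases b <;> simp only [halveStep, sz_pair, sz_cons, if_true, Bool.false_eq_true, if_false] <;>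
      omega

/-- Instead of converting `n` to unary, the list is shortened along the binary digits: its length is
at most `b + 2 * v` if and only if, after removing `b` entries and halving with rounding up, it is
at most `v`. When the digits are used up, the list has to be empty. -/
theorem length_le {l : T → List S} {n : T → ℕ} (hl : PolyTime l) (hn : PolyTime n) :
    PolyTime (fun t => (l t).length ≤ n t) := by
  have h : ∀ (w : List Bool) (l : List S),
      w.foldl (fun l b => HDRR.halve (if b then l.tail else l)) l = [] ↔ l.length ≤ binVal w := by
    intro w
    induction w with
    | nil => simp [binVal]
    | cons b w ih =>
      intro l
      rw [List.foldl_cons, ih, length_halve]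
      have e : binVal (b :: w) = b.toNat + 2 * binVal w := rfl
      rw [e]
      cases b <;> simp <;> omega
  have key : PolyTime (fun t => (Computability.encodeNat (n t)).foldl
      (fun l b => HDRR.halve (if b then l.tail else l)) (l t)) := by
    refine foldl (f := fun _ (l : List S) (b : Bool) => HDRR.halve (if b then l.tail else l)) ?_ hl
      hn.encodeNat 0 fun t u b _ => ?_
    · exact (ite (c := fun p : T × List S × Bool => p.2.2) (by fun_prop) (by fun_prop)
        (by fun_prop)).halve
    · refine (sz_halve_le _).trans ?_
      cases b
      · simp
      · cases u <;> simp; omega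
  exact key.eq_nil.congr_iff fun t => by rw [h, binVal_encodeNat]

end PolyTime

/-! ### Labelling a list with the bits of a word -/

/-- Labels the entries of a list with the bits of a word, and with `false` beyond its end. -/
def labelled {S : Type} : List S → List Bool → List (S × Bool)
  | [], _ => []
  | a :: l, w => (a, w.headD false) :: labelled l w.tail

@[fun_prop]
theorem PolyTime.labelled {l : T → List S} {w : T → List Bool} (hl : PolyTime l)
    (hw : PolyTime w) : PolyTime (fun t => labelled (l t) (w t)) := by
  obtain ⟨ql, hql⟩ := hl.sz_le
  have h : ∀ (l : List S) (w : List Bool) (r : List (S × Bool)),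
      (l.foldl (fun c s => (c.1.tail, (s, c.1.headD false) :: c.2)) (w, r)).2.reverse =
      r.reverse ++ HDRR.labelled l w := by
    intro l
    induction l with
    | nil => simp [HDRR.labelled]
    | cons a l ih => intro w r; rw [List.foldl_cons, ih]; simp [HDRR.labelled]
  have key : PolyTime (fun t => (l t).foldl (fun (c : List Bool × List (S × Bool)) s =>
      (c.1.tail, (s, c.1.headD false) :: c.2)) (w t, [])) := by
    refine foldl (f := fun _ (c : List Bool × List (S × Bool)) s =>
      (c.1.tail, (s, c.1.headD false) :: c.2)) (b := fun t => (w t, [])) (by fun_prop)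
      (by fun_prop) hl (5 + ql) fun t u s hs => ?_
    have h₁ := (sz_le_of_mem hs).trans (hql t)
    obtain ⟨v, r⟩ := u
    have h₂ := sz_bool (v.headD false)
    have h₃ : sz v.tail ≤ sz v := by cases v <;> simp; omega
    simp only [Polynomial.eval_add, Polynomial.eval_ofNat, sz_pair, sz_cons]
    omega
  exact key.snd'.reverse.congr fun t => by rw [h]; simp

/-! ### Decoding -/

/-- Values that can be recovered from their representation in polynomial time. Every tree is
decoded to some value. -/
class Dec (T : Type) [Enc T] where
  dec : Dat → T
  dec_enc : ∀ t : T, dec (enc t) = t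
  polyTime_dec : PolyTime dec

open Dec

@[fun_prop]
theorem PolyTime.dec [Dec U] {f : T → Dat} (hf : PolyTime f) :
    PolyTime (fun t => (dec (f t) : U)) := polyTime_dec.comp hf

instance : Dec Bool where
  dec d := d.isCons
  dec_enc b := by cases b <;> rfl
  polyTime_dec := by
    classical
    exact (show PolyTime (fun d : Dat => decide (¬ d.toList = [])) by fun_prop).congr
      fun d => by cases d <;> simp [Dat.toList, Dat.isCons]

instance : Dec ℕ where
  dec d := decodeNat (d.toList.map dec)
  dec_enc n := by
    change decodeNat ((Dat.ofList ((encodeNat n).map enc)).toList.map dec) = n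
    have h : ∀ l : List Bool, (Dat.ofList (l.map enc)).toList.map dec = l := by
      intro l
      induction l with
      | nil => rfl
      | cons b l ih => simp [Dat.ofList, Dat.toList, ih, dec_enc]
    rw [h, decode_encodeNat]
  polyTime_dec := (PolyTime.map (g := fun _ d => (dec d : Bool)) (by fun_prop)
    (by fun_prop)).decodeNat

end Calculus

/-! ### Verifiers -/

noncomputable instance : Enc (Option (Γ' ⊕ Bool)) := ⟨encFinite _⟩

/-- One step of splitting the input of a verifier, from right to left, into the input word and the
guesses; the last component is the part of a guess that has been read. -/
def splitStep (a : Option (Γ' ⊕ Bool)) (c : List Γ' × List (List Bool) × List Bool) :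
    List Γ' × List (List Bool) × List Bool :=
  match a with
  | none => (c.1, c.2.2 :: c.2.1, [])
  | some (Sum.inl g) => (g :: c.1, c.2.1, c.2.2)
  | some (Sum.inr b) => (c.1, c.2.1, b :: c.2.2)

/-- Each guess is preceded by its separator, so reading from right to left completes a guess exactly
when its separator is met, and none is left open. -/
theorem foldr_splitStep (a : List Γ' × List (List Bool)) :
    (verifierInput a).foldr splitStep ([], [], []) = (a.1, a.2, []) := by
  obtain ⟨x, ws⟩ := a
  have h₁ : ∀ (w : List Bool) (c : List Γ' × List (List Bool)),
      (w.map fun b => some (Sum.inr b)).foldr splitStep (c.1, c.2, []) = (c.1, c.2, w) := by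
    intro w c
    induction w with
    | nil => rfl
    | cons b w ih => rw [List.map_cons, List.foldr_cons, ih]; rfl
  have h₂ : (ws.flatMap fun w => none :: w.map fun b => some (Sum.inr b)).foldr splitStep
      ([], [], []) = ([], ws, []) := by
    induction ws with
    | nil => rfl
    | cons w ws ih =>
      rw [List.flatMap_cons, List.foldr_append, ih, List.foldr_cons, h₁ w ([], ws)]; rfl
  rw [verifierInput, List.foldr_append, h₂]
  induction x with
  | nil => rfl
  | cons g x ih => rw [List.map_cons, List.foldr_cons, ih]; rfl

theorem exists_sz_le {S : Type} [Enc S] [Finite S] : ∃ K, ∀ s : S, sz s ≤ K := by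
  obtain ⟨K, hK⟩ := (Set.finite_range (sz : S → ℕ)).bddAbove
  exact ⟨K, fun s => hK ⟨s, rfl⟩⟩

theorem PolyTime.splitStep :
    PolyTime (fun p : Option (Γ' ⊕ Bool) × List Γ' × List (List Bool) × List Bool =>
      splitStep p.1 p.2) := by
  refine finite_cases (encFinite_injective _) fun a => ?_
  rcases a with _ | g | b <;> unfold HDRR.splitStep <;> fun_prop

/-- The machine supplies the reversed input as a tree; a left fold over it is a right fold over the
input, which splits off the guesses before `V` is applied. -/
theorem computable_of_polyTime (V : List Γ' × List (List Bool) → Bool) (hV : PolyTime V) :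
    Nonempty (TM2ComputableInPolyTime verifierInput encodeBool V) := by
  obtain ⟨K, hK⟩ := exists_sz_le (S := Option (Γ' ⊕ Bool))
  obtain ⟨K', hK'⟩ := exists_sz_le (S := Γ')
  have hsplit : PolyTime (fun u : List (Option (Γ' ⊕ Bool)) =>
      u.foldl (fun c a => splitStep a c) ([], [], [])) := by
    refine PolyTime.foldl (f := fun _ c a => splitStep a c) (b := fun _ => ([], [], []))
      (PolyTime.splitStep.comp (f := fun p : List (Option (Γ' ⊕ Bool)) ×
        (List Γ' × List (List Bool) × List Bool) × Option (Γ' ⊕ Bool) => (p.2.2, p.2.1))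
        (by fun_prop)) (by fun_prop) (by fun_prop) (Polynomial.C (K' + 10)) fun t u a _ => ?_
    obtain ⟨x, ws, w⟩ := u
    rw [Polynomial.eval_C]
    rcases a with _ | g | b
    · simp only [splitStep, sz_pair, sz_cons, sz_nil]; omega
    · have := hK' g
      simp only [splitStep, sz_pair, sz_cons]; omega
    · have := sz_bool b
      simp only [splitStep, sz_pair, sz_cons]; omega
  have h : PolyTime (fun u : List (Option (Γ' ⊕ Bool)) =>
      V ((u.foldl (fun c a => splitStep a c) ([], [], [])).1,
        (u.foldl (fun c a => splitStep a c) ([], [], [])).2.1)) :=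
    hV.comp (hsplit.fst'.pair hsplit.snd'.fst')
  obtain ⟨p, q, hp⟩ := h
  refine computable_of_run (encFinite _) p verifierInput V
    -- `q` bounds the time and the size of the result separately, hence the factor 2. The input tree
    -- has at most `K + 1` nodes per symbol and a final leaf.
    (2 * q.comp (Polynomial.C (K + 1) * Polynomial.X + 1)) fun a => ?_
  obtain ⟨h₁, n, hn, hr⟩ := hp (verifierInput a).reverse
  beta_reduce at h₁ hr
  simp only [List.foldl_reverse, foldr_splitStep] at h₁ hr
  have e : ∀ (u : List (Option (Γ' ⊕ Bool))) (l : List (Option (Γ' ⊕ Bool))),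
      u.foldl (fun l a => Dat.cons (encFinite _ a) l) (enc l) = enc (u.reverse ++ l) := by
    intro u
    induction u with
    | nil => exact fun l => rfl
    | cons a u ih =>
      intro l
      rw [List.foldl_cons, List.reverse_cons, List.append_assoc]
      exact ih (a :: l)
  have hs : ∀ u : List (Option (Γ' ⊕ Bool)), sz u ≤ (K + 1) * u.length + 1 := by
    intro u
    induction u with
    | nil => simp
    | cons a u ih =>
      have := hK a
      rw [sz_cons, List.length_cons, Nat.mul_add]; omega
  have h₂ := eval_mono q (hs (verifierInput a).reverse)
  rw [List.length_reverse] at h₂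
  refine ⟨enc (V a), n, by cases V a <;> rfl, ?_, ?_⟩
  · simp only [Polynomial.eval_mul, Polynomial.eval_ofNat, Polynomial.eval_comp,
      Polynomial.eval_add, Polynomial.eval_C, Polynomial.eval_X, Polynomial.eval_one]
    change n + sz (V a) ≤ _
    have : sz (V a) ≤ q.eval (sz (verifierInput a).reverse) := h₁
    omega
  · have := hr [] [] [] []
    rw [← enc_nil (T := Option (Γ' ⊕ Bool)), e, List.append_nil]
    simpa using this

open Dec

section

variable {S T U V W : Type} [Enc S] [Enc T] [Enc U] [Enc V] [Enc W]

/-! ### Reading words -/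

/-- One step of reading a word, from right to left, with a stack of the lists that are open. -/
def parseStep : Γ' → Dat → Dat
  | .ket, d => .cons .nil d
  | .comma, d => .cons (.cons .nil d.left) d.right
  | .bit b, d => .cons (.cons (.cons (enc b) d.left.left) d.left.right) d.right
  | .bra, d => .cons (.cons d.left d.right.left) d.right.right
  | .blank, d => d

/-- The tree of the nested lists of numbers that are written in a word. -/
def parse (w : List Γ') : Dat := (w.foldr parseStep (.cons .nil .nil)).left

/-- Reading `w` prepends the entries `l` to the list that is open. -/
def Reads (w : List Γ') (l : List Dat) : Prop :=
  ∀ top rest : Dat, w.foldr parseStep (.cons top rest) = .cons (l.foldr .cons top) rest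

theorem Reads.nil : Reads [] [] := fun _ _ => rfl

theorem Reads.append {w w' : List Γ'} {l l' : List Dat} (h : Reads w l) (h' : Reads w' l') :
    Reads (w ++ w') (l ++ l') := fun top rest => by
  rw [List.foldr_append, List.foldr_append, h', h]

theorem Reads.flatMap {β : Type} {e : β → List Γ'} {d : β → List Dat} (h : ∀ b, Reads (e b) (d b))
    (l : List β) : Reads (l.flatMap e) (l.flatMap d) := by
  induction l with
  | nil => exact .nil
  | cons b l ih => exact (h b).append ih

theorem foldr_cons_nil (l : List Dat) : l.foldr .cons .nil = enc l := by
  induction l with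
  | nil => rfl
  | cons a l ih => rw [List.foldr_cons, ih]; rfl

/-- Read from the right, the closing bracket opens an empty list on the stack, the entries are
prepended to it, and the opening bracket moves the finished list into the one below. -/
theorem Reads.list {β : Type} {e : β → List Γ'} {d : β → List Dat} (h : ∀ b, Reads (e b) (d b))
    (l : List β) : Reads (encodeList e l) [enc (l.flatMap d)] := fun top rest => by
  have h₁ := Reads.flatMap h l .nil (.cons top rest)
  rw [encodeList, List.foldr_cons, List.foldr_append, List.foldr_cons, List.foldr_nil, parseStep,
    h₁, foldr_cons_nil]
  rfl

theorem foldr_bits (w : List Bool) (l : List Bool) (top rest : Dat) :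
    (w.map Γ'.bit).foldr parseStep (.cons (.cons (enc l) top) rest) =
      .cons (.cons (enc (w ++ l)) top) rest := by
  induction w with
  | nil => rfl
  | cons b w ih => rw [List.map_cons, List.foldr_cons, ih]; rfl

theorem Reads.number (n : ℕ) : Reads (encodeNumber n) [enc n] := fun top rest => by
  rw [encodeNumber, List.foldr_append]
  refine (foldr_bits _ [] top rest).trans ?_
  rw [List.append_nil]
  rfl

/-- What reading a literal results in. -/
def literalDat (l : Literal) : Dat := .cons (enc l.2) (enc l.1)

/-- The sign precedes the digits as a further bit, so it becomes the head of the digit list just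
read. -/
theorem Reads.literal (l : Literal) : Reads (encodeLiteral l) [literalDat l] := fun top rest => by
  rw [encodeLiteral, List.foldr_cons, Reads.number]
  rfl

theorem Reads.clause (c : Clause) : Reads (encodeClause c) (c.literals.map literalDat) := by
  have := Reads.flatMap Reads.literal c.literals
  rwa [← List.map_eq_flatMap] at this

theorem enc_prepend (l : List Dat) (d : Dat) : (l.foldr Dat.cons d).toList = l ++ d.toList := by
  induction l with
  | nil => rfl
  | cons a l ih => simp [Dat.toList, ih]

theorem Reads.toList_parse {w : List Γ'} {l : List Dat} (h : Reads w l) : (parse w).toList = l := by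
  rw [parse, h]
  exact (enc_prepend l .nil).trans (List.append_nil l)

/-! ### Cutting a list into pieces -/

open Classical in
/-- One step of cutting a list into pieces of length `k`, from right to left. -/
noncomputable def chunkStep (k : ℕ) (a : Dat) (c : List Dat × List (List Dat)) :
    List Dat × List (List Dat) :=
  if (a :: c.1).length = k then ([], (a :: c.1) :: c.2) else (a :: c.1, c.2)

/-- The pieces of length `k` of a list. -/
noncomputable def chunks (k : ℕ) (l : List Dat) : List (List Dat) :=
  (l.foldr (chunkStep k) ([], [])).2

/-- Clauses, pairs of sets and stages are written without brackets of their own, so they are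
recovered from the flattened list by their constant length. -/
theorem chunks_flatMap {β : Type} (k : ℕ) (hk : k ≠ 0) (g : β → List Dat)
    (hg : ∀ b, (g b).length = k) (l : List β) : chunks k (l.flatMap g) = l.map g := by
  have h₁ : ∀ (b : List Dat) (r : List (List Dat)), b.length < k →
      b.foldr (chunkStep k) ([], r) = (b, r) := by
    intro b r
    induction b with
    | nil => exact fun _ => rfl
    | cons a b ih =>
      intro h
      rw [List.foldr_cons, ih (by simp at h; omega), chunkStep, if_neg h.ne]
  have h₂ : (l.flatMap g).foldr (chunkStep k) ([], []) = ([], l.map g) := by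
    induction l with
    | nil => rfl
    | cons b l ih =>
      rw [List.flatMap_cons, List.foldr_append, ih]
      have := hg b
      cases h : g b with
      | nil => simp [h] at this; omega
      | cons a b' =>
        rw [h] at this
        rw [List.foldr_cons, h₁ b' _ (by simp at this; omega), chunkStep, if_pos this, List.map_cons,
          h]
  rw [chunks, h₂]

/-- The literal that results from a tree. -/
def decLiteral (d : Dat) : Literal := (dec d.right, dec d.left)

theorem decLiteral_literalDat (l : Literal) : decLiteral (literalDat l) = l :=
  Prod.ext (dec_enc l.1) (dec_enc l.2)

/-- The clause that results from three trees. -/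
def decClause (c : List Dat) : Clause :=
  (decLiteral (c.headD .nil), decLiteral (c.tail.headD .nil), decLiteral (c.tail.tail.headD .nil))

theorem decClause_literals (c : Clause) : decClause (c.literals.map literalDat) = c := by
  simp [decClause, Clause.literals, decLiteral_literalDat]

/-- The set of literals that results from a tree. -/
def decLiterals (d : Dat) : List Literal := d.toList.map decLiteral

theorem decLiterals_enc (l : List Literal) : decLiterals (enc (l.map literalDat)) = l := by
  have h : (enc (l.map literalDat) : Dat).toList = l.map literalDat := by
    rw [← foldr_cons_nil, enc_prepend]; simp [Dat.toList]
  rw [decLiterals, h, List.map_map]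
  exact (List.map_congr_left fun l _ => decLiteral_literalDat l).trans (List.map_id l)

theorem Reads.literals (l : List Literal) :
    Reads (encodeList encodeLiteral l) [enc (l.map literalDat)] := by
  have := Reads.list Reads.literal l
  rwa [← List.map_eq_flatMap] at this

/-! ### Reading, writing and checking in polynomial time -/

namespace PolyTime

theorem parseStep : PolyTime (fun p : Γ' × Dat => parseStep p.1 p.2) := by
  refine finite_cases (encFinite_injective _) fun a => ?_
  rcases a with _ | b | _ | _ | _ <;> unfold HDRR.parseStep <;> fun_prop

@[fun_prop]
theorem parse {w : T → List Γ'} (hw : PolyTime w) : PolyTime (fun t => parse (w t)) := by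
  refine PolyTime.left ?_
  refine foldr (f := fun _ => HDRR.parseStep) (b := fun _ => .cons .nil .nil) (parseStep.comp snd)
    -- A step only rearranges subtrees and adds boundedly many nodes; 10 is a generous bound.
    (by fun_prop) hw 10 fun t a d _ => ?_
  have h₁ := d.sz_left_add_sz_right
  have h₂ := d.left.sz_left_add_sz_right
  have h₃ := d.right.sz_left_add_sz_right
  have e : ∀ a b : Dat, sz (Dat.cons a b) = 1 + (sz a + sz b) := fun _ _ => rfl
  have e' : sz Dat.nil = 1 := rfl
  rw [Polynomial.eval_ofNat]
  rcases a with _ | b | _ | _ | _ <;> simp only [HDRR.parseStep, e, e'] <;> try omega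
  have h₄ : sz (Enc.enc b) ≤ 3 := sz_bool b
  omega

@[fun_prop]
theorem chunks (k : ℕ) {l : T → List Dat} (hl : PolyTime l) :
    PolyTime (fun t => chunks k (l t)) := by
  classical
  obtain ⟨ql, hql⟩ := hl.sz_le
  refine PolyTime.snd' (f := fun t => (l t).foldr (chunkStep k) ([], [])) ?_
  refine foldr (f := fun _ => chunkStep k) (b := fun _ => ([], [])) ?_ (by fun_prop) hl (4 + ql)
    fun t a c ha => ?_
  · refine ite_prop (P := fun p : T × Dat × List Dat × List (List Dat) =>
      (p.2.1 :: p.2.2.1).length = k) (length_eq (by fun_prop) k) (by fun_prop) (by fun_prop)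
  · have := (sz_le_of_mem ha).trans (hql t)
    obtain ⟨r, c⟩ := c
    simp only [Polynomial.eval_add, Polynomial.eval_ofNat]
    unfold chunkStep
    split_ifs <;> simp only [sz_pair, sz_cons, sz_nil] <;> omega

@[fun_prop]
theorem decLiteral {f : T → Dat} (hf : PolyTime f) : PolyTime (fun t => decLiteral (f t)) := by
  unfold HDRR.decLiteral; fun_prop

@[fun_prop]
theorem decClause {f : T → List Dat} (hf : PolyTime f) : PolyTime (fun t => decClause (f t)) := by
  unfold HDRR.decClause; fun_prop

@[fun_prop]
theorem decLiterals {f : T → Dat} (hf : PolyTime f) : PolyTime (fun t => decLiterals (f t)) :=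
  map (g := fun _ d => HDRR.decLiteral d) (by fun_prop) (by fun_prop)

/-! ### Writing words -/

theorem encodeList {β : Type} [Enc β] {e : β → List Γ'} (he : PolyTime e) {l : T → List β}
    (hl : PolyTime l) : PolyTime (fun t => encodeList e (l t)) :=
  (const Γ'.bra).cons ((flatMap (g := fun _ b => e b) (he.comp snd) hl).append (const [Γ'.ket]))

@[fun_prop]
theorem encodeNumber {n : T → ℕ} (hn : PolyTime n) : PolyTime (fun t => encodeNumber (n t)) :=
  (map (g := fun _ b => Γ'.bit b) (by fun_prop) hn.encodeNat).append (const [Γ'.comma])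

@[fun_prop]
theorem encodeLiteral {l : T → Literal} (hl : PolyTime l) :
    PolyTime (fun t => encodeLiteral (l t)) := by
  unfold HDRR.encodeLiteral; fun_prop

@[fun_prop]
theorem clauseLiterals {c : T → Clause} (hc : PolyTime c) :
    PolyTime (fun t => (c t).literals) := by
  unfold Clause.literals; fun_prop

@[fun_prop]
theorem encodeClause {c : T → Clause} (hc : PolyTime c) : PolyTime (fun t => encodeClause (c t)) :=
  flatMap (g := fun _ l => HDRR.encodeLiteral l) (by fun_prop) (by fun_prop)

@[fun_prop]
theorem encodeLiterals {l : T → List Literal} (hl : PolyTime l) :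
    PolyTime (fun t => HDRR.encodeList HDRR.encodeLiteral (l t)) :=
  encodeList (encodeLiteral id) hl

/-! ### Solutions and distances -/

theorem isSolution {C : T → List Clause} {σ s : T → List Literal} (hC : PolyTime C)
    (hσ : PolyTime σ) (hs : PolyTime s) :
    PolyTime (fun t => IsSolution (C t) (σ t).toFinset (s t).toFinset) := by
  have h₁ : PolyTime (fun t => ∀ l ∈ s t, l ∈ σ t) := forall_mem (by fun_prop) hs
  -- The condition is void for variables without an active literal, so the unbounded quantifier over
  -- variables may run over the entries of `σ`.
  have h₂ : PolyTime (fun t => ∀ l ∈ σ t, (l.1, true) ∈ σ t → (l.1, false) ∈ σ t →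
      ((l.1, true) ∈ s t ↔ (l.1, false) ∉ s t)) :=
    forall_mem (P := fun t l => (l.1, true) ∈ σ t → (l.1, false) ∈ σ t →
      ((l.1, true) ∈ s t ↔ (l.1, false) ∉ s t))
      (imp (by fun_prop) (imp (by fun_prop) (by fun_prop))) hσ
  have h₃ : PolyTime (fun t => ∀ c ∈ C t, (∀ l ∈ Clause.literals c, l ∈ σ t) →
      ∃ l ∈ Clause.literals c, l ∈ s t) :=
    forall_mem (P := fun t c => (∀ l ∈ Clause.literals c, l ∈ σ t) →
      ∃ l ∈ Clause.literals c, l ∈ s t)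
      (imp (forall_mem (P := fun (p : T × Clause) l => l ∈ σ p.1) (by fun_prop) (by fun_prop))
        (exists_mem (P := fun (p : T × Clause) l => l ∈ s p.1) (by fun_prop) (by fun_prop))) hC
  refine (h₁.and (h₂.and h₃)).congr_iff fun t => ?_
  unfold IsSolution
  simp only [List.mem_toFinset]
  refine and_congr ?_ (and_congr ⟨fun h v hv => h (v, true) hv hv, fun h l _ => h l.1⟩ Iff.rfl)
  exact ⟨fun h l hl => List.mem_toFinset.2 (h l (List.mem_toFinset.1 hl)),
    fun h l hl => List.mem_toFinset.1 (h (List.mem_toFinset.2 hl))⟩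

theorem dedup [DecidableEq S] [PolyEq S] {l : T → List S} (hl : PolyTime l) :
    PolyTime (fun t => (l t).dedup) := by
  obtain ⟨ql, hql⟩ := hl.sz_le
  refine (foldr (f := fun _ s r => if s ∈ r then r else s :: r) (b := fun _ => []) (by fun_prop)
    (by fun_prop) hl (1 + ql) fun t s r hs => ?_).congr fun t => ?_
  · have := (sz_le_of_mem hs).trans (hql t)
    simp only [Polynomial.eval_add, Polynomial.eval_one]
    split_ifs
    · omega
    · simp only [sz_cons]; omega
  · induction l t with
    | nil => rfl
    | cons s l ih =>
      rw [List.foldr_cons, ih]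
      split_ifs with h
      · exact (List.dedup_cons_of_mem' h).symm
      · exact (List.dedup_cons_of_notMem' h).symm

/-- The symmetric difference is listed as the two differences; the lists may contain repetitions,
which are removed before counting. -/
theorem hamming_le {s s' : T → List Literal} {n : T → ℕ} (hs : PolyTime s) (hs' : PolyTime s')
    (hn : PolyTime n) :
    PolyTime (fun t => hamming (s t).toFinset (s' t).toFinset ≤ n t) := by
  have h : PolyTime (fun t => ((s t).filter (fun l => Decidable.decide (l ∉ s' t)) ++
      (s' t).filter (fun l => Decidable.decide (l ∉ s t))).dedup) :=
    ((filter (P := fun t l => Decidable.decide (l ∉ s' t)) (by fun_prop) hs).append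
      (filter (P := fun t l => Decidable.decide (l ∉ s t)) (by fun_prop) hs')).dedup
  refine (h.length_le hn).congr_iff fun t => ?_
  rw [hamming, ← List.card_toFinset]
  have : ((s t).filter (fun l => Decidable.decide (l ∉ s' t)) ++
      (s' t).filter (fun l => Decidable.decide (l ∉ s t))).toFinset = (s t).toFinset ∆ (s' t).toFinset := by
    ext l
    simp [Finset.mem_symmDiff]
  rw [this]

end PolyTime

end

/-! ### Choosing sublists -/

/-- The entries of a list that are labelled with `true`. -/
def pick {S : Type} (l : List S) (w : List Bool) : List S :=
  ((labelled l w).filter fun c => c.2).map Prod.fst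

theorem PolyTime.pick {S T : Type} [Enc S] [Enc T] {l : T → List S} {w : T → List Bool}
    (hl : PolyTime l) (hw : PolyTime w) : PolyTime (fun t => pick (l t) (w t)) :=
  map (g := fun _ (c : S × Bool) => c.1) (by fun_prop)
    (filter (P := fun _ (c : S × Bool) => c.2) (by fun_prop) (hl.labelled hw))

theorem map_fst_labelled {S : Type} (l : List S) (w : List Bool) :
    (labelled l w).map Prod.fst = l := by
  induction l generalizing w with
  | nil => rfl
  | cons a l ih => rw [labelled, List.map_cons, ih]

theorem pick_sublist {S : Type} (l : List S) (w : List Bool) : (pick l w).Sublist l := by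
  induction l generalizing w with
  | nil => exact List.Sublist.refl _
  | cons a l ih =>
    have := ih w.tail
    unfold pick at this ⊢
    rw [labelled, List.filter_cons]
    split_ifs
    · exact this.cons_cons a
    · exact this.cons a

theorem exists_pick_eq {S : Type} {l l' : List S} (h : l'.Sublist l) :
    ∃ w : List Bool, w.length = l.length ∧ pick l w = l' := by
  induction h with
  | slnil => exact ⟨[], rfl, rfl⟩
  | cons a h ih =>
    obtain ⟨w, hw, rfl⟩ := ih
    exact ⟨false :: w, by simp [hw], rfl⟩
  | cons_cons a h ih =>
    obtain ⟨w, hw, rfl⟩ := ih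
    exact ⟨true :: w, by simp [hw], rfl⟩

theorem length_le_length_flatMap {β γ : Type} {e : β → List γ} (h : ∀ b, e b ≠ []) (l : List β) :
    l.length ≤ (l.flatMap e).length := by
  induction l with
  | nil => simp
  | cons b l ih =>
    have := List.length_pos_iff.2 (h b)
    rw [List.flatMap_cons, List.length_append, List.length_cons]; omega

theorem length_le_length_encodeList {β : Type} {e : β → List Γ'} (h : ∀ b, e b ≠ []) (l : List β) :
    l.length ≤ (encodeList e l).length := by
  have := length_le_length_flatMap h l
  simp only [encodeList, List.length_cons, List.length_append]; omega

theorem length_le_length_encodeList_of_mem {β : Type} (e : β → List Γ') {l : List β} {b : β}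
    (h : b ∈ l) : (e b).length ≤ (encodeList e l).length := by
  have := (List.sublist_flatten_of_mem (List.mem_map_of_mem (f := e) h)).length_le
  rw [← List.flatMap_def] at this
  simp only [encodeList, List.length_cons, List.length_append]; omega

theorem toList_enc (l : List Dat) : (enc l : Dat).toList = l := by
  rw [← foldr_cons_nil, enc_prepend]; simp [Dat.toList]

/-! ### The two encodings of scenarios -/

/-- An encoding of sets of scenarios that can be read off the word of an instance, and whose
scenarios are described by words. -/
class StageEncoding (T : Type) [ScenarioEncoding T] [Enc T] where
  width : ℕ
  items : T → List Dat
  length_items : ∀ e, (items e).length = width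
  reads : ∀ e : T, Reads (ScenarioEncoding.word e) (items e)
  decode : List Dat → T
  -- The rest `r` leaves room for the bound `κ`, which follows the encoding in a stage.
  decode_items : ∀ e r, decode (items e ++ r) = e
  polyTime_decode : PolyTime decode
  polyTime_word : PolyTime (ScenarioEncoding.word : T → List Γ')
  polyTime_parts : PolyTime (ScenarioEncoding.parts : T → List (List Literal))
  Valid : T → List Bool → Prop
  scenario : T → List Bool → List Literal
  polyTime_valid : PolyTime fun p : T × List Bool => Valid p.1 p.2
  polyTime_scenario : PolyTime fun p : T × List Bool => scenario p.1 p.2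
  scenario_mem : ∀ e w, Valid e w → (scenario e w).toFinset ∈ ScenarioEncoding.scenarios e
  exists_scenario : ∀ e σ, σ ∈ ScenarioEncoding.scenarios e →
    ∃ w, w.length ≤ (ScenarioEncoding.word e).length ∧ Valid e w ∧ (scenario e w).toFinset = σ
  scenario_subset : ∀ e w, ∀ l ∈ scenario e w, ∃ E ∈ ScenarioEncoding.parts e, l ∈ E

section

variable {T : Type} [Enc T]

instance : Enc XorDependencies := ⟨fun e => enc (e.fixed, e.pairs)⟩

instance : Enc GammaSets := ⟨fun e => enc (e.fixed, e.sets, e.gamma)⟩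

/-! ### Components of the two scenario encodings -/

namespace PolyTime

@[fun_prop]
theorem xorFixed {e : T → XorDependencies} (he : PolyTime e) : PolyTime (fun t => (e t).fixed) :=
  fst.comp (he.of_enc_eq (g := fun t => ((e t).fixed, (e t).pairs)) (fun t => t) (fun _ => rfl)
    (fun _ => rfl))

@[fun_prop]
theorem xorPairs {e : T → XorDependencies} (he : PolyTime e) : PolyTime (fun t => (e t).pairs) :=
  snd.comp (he.of_enc_eq (g := fun t => ((e t).fixed, (e t).pairs)) (fun t => t) (fun _ => rfl)
    (fun _ => rfl))

theorem xorMk {E : T → List Literal} {P : T → List (List Literal × List Literal)}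
    (hE : PolyTime E) (hP : PolyTime P) : PolyTime (fun t => XorDependencies.mk (E t) (P t)) :=
  (hE.pair hP).of_enc_eq (fun t => t) (fun _ => rfl) (fun _ => rfl)

theorem gammaTuple {e : T → GammaSets} (he : PolyTime e) :
    PolyTime (fun t => ((e t).fixed, (e t).sets, (e t).gamma)) :=
  he.of_enc_eq (fun t => t) (fun _ => rfl) (fun _ => rfl)

@[fun_prop]
theorem gammaFixed {e : T → GammaSets} (he : PolyTime e) : PolyTime (fun t => (e t).fixed) :=
  he.gammaTuple.fst'

@[fun_prop]
theorem gammaSets {e : T → GammaSets} (he : PolyTime e) : PolyTime (fun t => (e t).sets) :=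
  he.gammaTuple.snd'.fst'

@[fun_prop]
theorem gammaGamma {e : T → GammaSets} (he : PolyTime e) : PolyTime (fun t => (e t).gamma) :=
  he.gammaTuple.snd'.snd'

theorem gammaMk {E : T → List Literal} {P : T → List (List Literal)} {n : T → ℕ}
    (hE : PolyTime E) (hP : PolyTime P) (hn : PolyTime n) :
    PolyTime (fun t => GammaSets.mk (E t) (P t) (n t)) :=
  (hE.pair (hP.pair hn)).of_enc_eq (fun t => t) (fun _ => rfl) (fun _ => rfl)

end PolyTime

/-- The set that is selected from a pair by a bit. -/
def selected (c : (List Literal × List Literal) × Bool) : List Literal :=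
  if c.2 then c.1.2 else c.1.1

theorem forall₂_selected (l : List (List Literal × List Literal)) (w : List Bool) :
    List.Forall₂ (fun q E => E = q.1 ∨ E = q.2) l ((labelled l w).map selected) := by
  induction l generalizing w with
  | nil => exact .nil
  | cons q l ih =>
    refine .cons ?_ (ih w.tail)
    unfold selected
    split_ifs
    · exact Or.inr rfl
    · exact Or.inl rfl

theorem exists_selected {l : List (List Literal × List Literal)} {r : List (List Literal)}
    (h : List.Forall₂ (fun q E => E = q.1 ∨ E = q.2) l r) :
    ∃ w : List Bool, w.length = l.length ∧ (labelled l w).map selected = r := by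
  induction h with
  | nil => exact ⟨[], rfl, rfl⟩
  | cons h _ ih =>
    obtain ⟨w, hw, rfl⟩ := ih
    rcases h with rfl | rfl
    · exact ⟨false :: w, by simp [hw], rfl⟩
    · exact ⟨true :: w, by simp [hw], rfl⟩

/-- What reading a pair of sets of literals results in. -/
def pairDat (q : List Literal × List Literal) : List Dat :=
  [enc (q.1.map literalDat), enc (q.2.map literalDat)]

/-- The pair of sets of literals that results from two trees. -/
def decPair (c : List Dat) : List Literal × List Literal :=
  (decLiterals (c.headD .nil), decLiterals (c.tail.headD .nil))

noncomputable instance : StageEncoding XorDependencies where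
  width := 2
  items e := [enc (e.fixed.map literalDat), enc (e.pairs.flatMap pairDat)]
  length_items _ := rfl
  reads e := (Reads.literals e.fixed).append
    (Reads.list (fun q => (Reads.literals q.1).append (Reads.literals q.2)) e.pairs)
  decode c := ⟨decLiterals (c.headD .nil), (chunks 2 (c.tail.headD .nil).toList).map decPair⟩
  decode_items e r := by
    have h : ∀ q : List Literal × List Literal, decPair (pairDat q) = q := fun q =>
      Prod.ext (decLiterals_enc q.1) (decLiterals_enc q.2)
    obtain ⟨E, P⟩ := e
    simp only [List.cons_append, List.headD_cons, List.tail_cons, decLiterals_enc, toList_enc]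
    rw [chunks_flatMap 2 (by simp) pairDat (fun _ => rfl), List.map_map]
    congr 1
    exact (List.map_congr_left fun q _ => h q).trans (List.map_id P)
  polyTime_decode := .xorMk (by fun_prop) (.map (g := fun _ c => decPair c)
    (by unfold decPair; fun_prop) (by fun_prop))
  polyTime_word := (PolyTime.encodeLiterals (by fun_prop)).append (.encodeList (by fun_prop)
    (by fun_prop))
  polyTime_parts := .cons (by fun_prop) (.flatMap (g := fun _ (q : List Literal × List Literal) => [q.1, q.2]) (by fun_prop)
    (by fun_prop))
  -- Every word makes a choice in each pair: missing bits count as `false` and surplus bits are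
  -- ignored.
  Valid _ _ := True
  scenario e w := e.fixed ++ ((labelled e.pairs w).map selected).flatten
  polyTime_valid := .const True
  polyTime_scenario := .append (by fun_prop) (.flatten (.map (g := fun _ c => selected c)
    (.ite (by fun_prop) (by fun_prop) (by fun_prop)) (by fun_prop)))
  scenario_mem e w _ := ⟨_, forall₂_selected e.pairs w, rfl⟩
  exists_scenario e σ := by
    rintro ⟨r, hr, rfl⟩
    obtain ⟨w, hw, rfl⟩ := exists_selected hr
    refine ⟨w, ?_, trivial, rfl⟩
    rw [hw]
    refine (length_le_length_encodeList ?_ e.pairs).trans (List.length_append ▸ Nat.le_add_left _ _)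
    intro q
    simp [encodeList]
  scenario_subset e w l hl := by
    rcases List.mem_append.1 hl with h | h
    · exact ⟨e.fixed, List.mem_cons_self, h⟩
    · obtain ⟨E, hE, h⟩ := List.mem_flatten.1 h
      refine ⟨E, List.mem_cons_of_mem _ ?_, h⟩
      obtain ⟨c, hc, rfl⟩ := List.mem_map.1 hE
      refine List.mem_flatMap.2 ⟨c.1, ?_, ?_⟩
      · rw [← map_fst_labelled e.pairs w]
        exact List.mem_map_of_mem hc
      · unfold selected
        split_ifs <;> simp

noncomputable instance : StageEncoding GammaSets where
  width := 3
  items e := [enc (e.fixed.map literalDat),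
    enc (e.sets.flatMap fun E : List Literal => [enc (E.map literalDat)]), enc e.gamma]
  length_items _ := rfl
  reads e := ((Reads.literals e.fixed).append (Reads.list Reads.literals e.sets)).append
    (Reads.number e.gamma)
  decode c := ⟨decLiterals (c.headD .nil), (c.tail.headD .nil).toList.map decLiterals,
    dec (c.tail.tail.headD .nil)⟩
  decode_items e r := by
    obtain ⟨E, P, n⟩ := e
    simp only [List.cons_append, List.headD_cons, List.tail_cons, decLiterals_enc, toList_enc,
      dec_enc, ← List.map_eq_flatMap, List.map_map]
    congr 1
    exact (List.map_congr_left fun E _ => decLiterals_enc E).trans (List.map_id P)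
  polyTime_decode := .gammaMk (by fun_prop) (.map (g := fun _ c => decLiterals c)
    (by fun_prop) (by fun_prop)) (by fun_prop)
  polyTime_word := .append (.append (by fun_prop) (.encodeList (.encodeLiterals .id) (by fun_prop)))
    (by fun_prop)
  polyTime_parts := .cons (by fun_prop) (by fun_prop)
  -- A word may select too many sets; such words describe no scenario.
  Valid e w := (pick e.sets w).length ≤ e.gamma
  scenario e w := e.fixed ++ (pick e.sets w).flatten
  polyTime_valid := .length_le (.pick (by fun_prop) (by fun_prop)) (by fun_prop)
  polyTime_scenario := .append (by fun_prop) (.flatten (.pick (by fun_prop) (by fun_prop)))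
  scenario_mem e w h := ⟨_, pick_sublist e.sets w, h, rfl⟩
  exists_scenario e σ := by
    rintro ⟨r, hr, hn, rfl⟩
    obtain ⟨w, hw, rfl⟩ := exists_pick_eq hr
    refine ⟨w, ?_, hn, rfl⟩
    rw [hw]
    refine (length_le_length_encodeList (e := encodeList encodeLiteral) ?_ e.sets).trans ?_
    · intro q
      simp [encodeList]
    · simp only [ScenarioEncoding.word, List.length_append]
      omega
  scenario_subset e w l hl := by
    rcases List.mem_append.1 hl with h | h
    · exact ⟨e.fixed, List.mem_cons_self, h⟩
    · obtain ⟨E, hE, h⟩ := List.mem_flatten.1 h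
      exact ⟨E, List.mem_cons_of_mem _ ((pick_sublist e.sets w).subset hE), h⟩

end

/-! ### Alternating quantifiers -/

/-- Every quantifier range contains the empty word, so a condition independent of the guesses passes
through universal quantifiers as well. -/
theorem alternation_const_and (B : ℕ) (k : ℕ) : ∀ (b : Bool) (c : Prop)
    (P : List (List Bool) → Prop),
    alternation B b k (fun ws => c ∧ P ws) ↔ c ∧ alternation B b k P := by
  induction k with
  | zero => intro b c P; cases b <;> exact Iff.rfl
  | succ k ih =>
    intro b c P
    cases b
    · simp only [alternation, ih]
      exact ⟨fun h => ⟨(h [] (Nat.zero_le _)).1, fun w hw => (h w hw).2⟩,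
        fun h w hw => ⟨h.1, h.2 w hw⟩⟩
    · simp only [alternation, ih]
      exact ⟨fun ⟨w, hw, h⟩ => ⟨h.1, w, hw, h.2⟩, fun ⟨h, w, hw, h'⟩ => ⟨w, hw, h, h'⟩⟩

theorem alternation_of_forall (B : ℕ) (k : ℕ) : ∀ (b : Bool) (P : List (List Bool) → Prop),
    (∀ ws, P ws) → alternation B b k P := by
  induction k with
  | zero => intro b P h; cases b <;> exact h []
  | succ k ih =>
    intro b P h
    cases b
    · exact fun w _ => ih true _ fun ws => h _
    · exact ⟨[], Nat.zero_le _, ih false _ fun ws => h _⟩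

theorem alternation_const_imp (B : ℕ) (k : ℕ) (b : Bool) (c : Prop) (P : List (List Bool) → Prop) :
    alternation B b k (fun ws => c → P ws) ↔ (c → alternation B b k P) := by
  by_cases hc : c
  · simp [hc]
  · simp only [hc, false_imp_iff, iff_true]
    exact alternation_of_forall _ _ _ _ fun _ => trivial

section

variable {T : Type} [Enc T] [ScenarioEncoding T] [StageEncoding T]

/-! ### Reading instances -/

/-- What reading a stage results in. -/
def stageDat (st : T × ℕ) : List Dat := StageEncoding.items st.1 ++ [enc st.2]

/-- The stage that results from a list of trees. -/
def decStage (c : List Dat) : T × ℕ := (StageEncoding.decode c, dec (c.reverse.headD .nil))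

theorem decStage_stageDat (st : T × ℕ) : decStage (stageDat st) = st :=
  Prod.ext (StageEncoding.decode_items st.1 _) (by simp [decStage, stageDat, dec_enc])

/-- What reading an instance results in. -/
def instanceDat (I : Instance T) : List Dat :=
  [enc (I.vars.flatMap fun n => [enc n]), enc (I.clauses.flatMap fun c => c.literals.map literalDat),
    enc (I.base.map literalDat), enc (I.stages.flatMap stageDat)]

theorem reads_word (I : Instance T) : Reads I.word (instanceDat I) :=
  (((Reads.list Reads.number I.vars).append (Reads.list Reads.clause I.clauses)).append
    (Reads.literals I.base)).append
    (Reads.list (fun st => (StageEncoding.reads st.1).append (Reads.number st.2)) I.stages)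

/-- The instance that results from reading a word. -/
noncomputable def readInstance (w : List Γ') : Instance T where
  vars := ((parse w).toList.headD .nil).toList.map dec
  clauses := (chunks 3 ((parse w).toList.tail.headD .nil).toList).map decClause
  base := decLiterals ((parse w).toList.tail.tail.headD .nil)
  stages := (chunks (StageEncoding.width T + 1)
    ((parse w).toList.tail.tail.tail.headD .nil).toList).map decStage

theorem readInstance_word (I : Instance T) : readInstance I.word = I := by
  rw [readInstance, (reads_word I).toList_parse]
  obtain ⟨vars, clauses, base, stages⟩ := I
  simp only [instanceDat, List.headD_cons, List.tail_cons, toList_enc, decLiterals_enc]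
  rw [chunks_flatMap 3 (by simp) _ (fun _ => rfl),
    chunks_flatMap _ (by simp) _ (fun st => by simp [stageDat, StageEncoding.length_items])]
  simp only [List.map_map, ← List.map_eq_flatMap]
  congr 1
  · exact (List.map_congr_left fun n _ => dec_enc n).trans (List.map_id _)
  · exact (List.map_congr_left fun c _ => decClause_literals c).trans (List.map_id _)
  · exact (List.map_congr_left fun st _ => decStage_stageDat st).trans (List.map_id _)

/-- A word in polynomial time is turned into the four parts of an instance. -/
theorem polyTime_readInstance : PolyTime (fun w => (readInstance w : Instance T).vars) ∧
    PolyTime (fun w => (readInstance w : Instance T).clauses) ∧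
    PolyTime (fun w => (readInstance w : Instance T).base) ∧
    PolyTime (fun w => (readInstance w : Instance T).stages) := by
  have h : PolyTime (fun c : List Dat => (decStage c : T × ℕ)) :=
    StageEncoding.polyTime_decode.pair (by fun_prop)
  refine ⟨.map (g := fun _ d => (dec d : ℕ)) (by fun_prop) (by fun_prop),
    .map (g := fun _ c => decClause c) (by fun_prop) (by fun_prop), ?_,
    .map (g := fun _ c => (decStage c : T × ℕ)) (h.comp .snd) (by fun_prop)⟩
  unfold readInstance
  fun_prop

/-- Reading is total and assigns an instance even to malformed words; comparing the input with the
word of that instance exposes them. -/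
theorem polyTime_word_readInstance : PolyTime (fun w => (readInstance w : Instance T).word) := by
  obtain ⟨h₁, h₂, h₃, h₄⟩ := polyTime_readInstance (T := T)
  refine .append (.append (.append (.encodeList (by fun_prop) h₁) (.encodeList (by fun_prop) h₂))
    (.encodeList (by fun_prop) h₃)) (.encodeList ?_ h₄)
  exact (StageEncoding.polyTime_word.comp .fst).append (by fun_prop)

theorem polyTime_wellFormed : PolyTime (fun w => (readInstance w : Instance T).WellFormed) := by
  obtain ⟨h₁, h₂, h₃, h₄⟩ := polyTime_readInstance (T := T)
  have hp : PolyTime (fun p : List Γ' × T × ℕ => ScenarioEncoding.parts p.2.1) :=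
    StageEncoding.polyTime_parts.comp (by fun_prop)
  have hmem : ∀ {S : Type} [Enc S] {f : S → List Γ'} {v : S → ℕ}, PolyTime f → PolyTime v →
      PolyTime (fun s => v s ∈ (readInstance (f s) : Instance T).vars) :=
    fun hf hv => hv.mem (h₁.comp hf)
  refine .and (.forall_mem (P := fun w c => ∀ l ∈ Clause.literals c,
      l.1 ∈ (readInstance w : Instance T).vars) ?_ h₂) (.and
    (.forall_mem (P := fun w l => l.1 ∈ (readInstance w : Instance T).vars) ?_ h₃)
    (.forall_mem (P := fun w st => (∀ E ∈ ScenarioEncoding.parts st.1, ∀ l ∈ E,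
      l.1 ∈ (readInstance w : Instance T).vars) ∧
      (ScenarioEncoding.parts st.1).Pairwise List.Disjoint) (.and ?_ ?_) h₄))
  · exact .forall_mem (P := fun (p : List Γ' × Clause) (l : Literal) =>
      l.1 ∈ (readInstance p.1 : Instance T).vars) (hmem (by fun_prop) (by fun_prop)) (by fun_prop)
  · exact hmem (by fun_prop) (by fun_prop)
  · refine .forall_mem (P := fun (p : List Γ' × T × ℕ) E => ∀ l ∈ E,
      l.1 ∈ (readInstance p.1 : Instance T).vars) ?_ hp
    exact .forall_mem (P := fun (p : (List Γ' × T × ℕ) × List Literal) (l : Literal) =>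
      l.1 ∈ (readInstance p.1.1 : Instance T).vars) (hmem (by fun_prop) (by fun_prop)) (by fun_prop)
  · refine .pairwise (P := fun _ E E' => List.Disjoint E E') ?_ hp
    exact (PolyTime.forall_mem (P := fun (p : (List Γ' × T × ℕ) × List Literal × List Literal) l =>
      ¬ l ∈ p.2.2) (by fun_prop) (l := fun p => p.2.1) (by fun_prop)).congr_iff fun p => by
        simp [List.Disjoint]

/-! ### The verifier -/

/-- The literals of a list of variables. -/
def literalsOf (vars : List ℕ) : List Literal := vars.flatMap fun v => [(v, true), (v, false)]

theorem mem_literalsOf {vars : List ℕ} {l : Literal} : l ∈ literalsOf vars ↔ l.1 ∈ vars := by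
  obtain ⟨v, b⟩ := l
  cases b <;> simp [literalsOf]

theorem length_literalsOf (vars : List ℕ) : (literalsOf vars).length = 2 * vars.length := by
  induction vars with
  | nil => rfl
  | cons v vars ih =>
    rw [literalsOf, List.flatMap_cons, ← literalsOf, List.length_append, ih, List.length_cons]
    simp; omega

/-- One bit for each of the two literals of every listed variable marks membership in `s`; repeated
variables do no harm. -/
theorem exists_pick_toFinset_eq {vars : List ℕ} {s : Finset Literal} (hs : ∀ l ∈ s, l.1 ∈ vars) :
    ∃ w : List Bool, w.length ≤ 2 * vars.length ∧ (pick (literalsOf vars) w).toFinset = s := by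
  obtain ⟨w, hw, h⟩ := exists_pick_eq (List.filter_sublist (l := literalsOf vars)
    (p := fun l => decide (l ∈ s)))
  refine ⟨w, by rw [hw, length_literalsOf], ?_⟩
  rw [h]
  ext l
  simp only [List.mem_toFinset, List.mem_filter, mem_literalsOf, decide_eq_true_eq]
  exact ⟨fun h => h.2, fun h => ⟨hs l h, h⟩⟩

/-- Checks the guesses for `k` stages: `c` are the clauses and the literals of the instance, `s` is
the solution from which to recover. The guesses are alternatingly scenarios and solutions. -/
def CheckStages : ℕ → List Clause × List Literal → List (T × ℕ) → List Literal →
    List (List Bool) → Prop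
  | 0, _, _, _, _ => True
  | _ + 1, _, [], _, _ => True
  | k + 1, c, st :: stages, s, ws =>
      StageEncoding.Valid st.1 (ws.headD []) →
        IsSolution c.1 (StageEncoding.scenario st.1 (ws.headD [])).toFinset
          (pick c.2 (ws.tail.headD [])).toFinset ∧
        hamming s.toFinset (pick c.2 (ws.tail.headD [])).toFinset ≤ st.2 ∧
        CheckStages k c stages (pick c.2 (ws.tail.headD [])) ws.tail.tail

/-- The data on which `CheckStages` depends. -/
abbrev CheckInput (T : Type) : Type :=
  (List Clause × List Literal) × List (T × ℕ) × List Literal × List (List Bool)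

/-- The number of stages is fixed, so the recursion unrolls into boundedly many compositions and
polynomial bounds persist. -/
theorem polyTime_checkStages (k : ℕ) : PolyTime (fun p : CheckInput T =>
    CheckStages k p.1 p.2.1 p.2.2.1 p.2.2.2) := by
  induction k with
  | zero => exact .const True
  | succ k ih =>
    have hpick : ∀ {S : Type} [Enc S] {l : S → List Literal} {ws : S → List (List Bool)},
        PolyTime l → PolyTime ws → PolyTime (fun s => pick (l s) ((ws s).tail.headD [])) :=
      fun hl hws => .pick hl (by fun_prop)
    have h : PolyTime (fun q : CheckInput T × (T × ℕ) × List (T × ℕ) =>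
        StageEncoding.Valid q.2.1.1 (q.1.2.2.2.headD []) →
        IsSolution q.1.1.1 (StageEncoding.scenario q.2.1.1 (q.1.2.2.2.headD [])).toFinset
          (pick q.1.1.2 (q.1.2.2.2.tail.headD [])).toFinset ∧
        hamming q.1.2.2.1.toFinset (pick q.1.1.2 (q.1.2.2.2.tail.headD [])).toFinset ≤ q.2.1.2 ∧
        CheckStages k q.1.1 q.2.2 (pick q.1.1.2 (q.1.2.2.2.tail.headD [])) q.1.2.2.2.tail.tail) := by
      have hp : PolyTime (fun q : CheckInput T × (T × ℕ) × List (T × ℕ) =>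
          pick q.1.1.2 (q.1.2.2.2.tail.headD [])) := hpick (by fun_prop) (by fun_prop)
      have hq : PolyTime (fun q : CheckInput T × (T × ℕ) × List (T × ℕ) => (q.2.1.1, q.1.2.2.2.headD [])) := by
        fun_prop
      refine .imp (StageEncoding.polyTime_valid.comp hq) (.and (.isSolution (by fun_prop)
        (StageEncoding.polyTime_scenario.comp hq) hp) (.and (.hamming_le (by fun_prop) hp
        (by fun_prop)) ?_))
      exact ih.comp (f := fun q : CheckInput T × (T × ℕ) × List (T × ℕ) => (q.1.1, q.2.2,
        pick q.1.1.2 (q.1.2.2.2.tail.headD []), q.1.2.2.2.tail.tail))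
        (.pair (by fun_prop) (.pair (by fun_prop) (.pair hp (by fun_prop))))
    refine (PolyTime.listCases (l := fun p : CheckInput T => p.2.1) (f := fun _ => True) (by fun_prop)
      (by fun_prop) h).congr fun p => ?_
    obtain ⟨c, _ | ⟨st, stages⟩, s, ws⟩ := p <;> rfl

/-- Each stage uses one universal guess for the scenario and one existential guess for the solution.
Valid words describe exactly the scenarios, invalid ones satisfy the check vacuously, and a solution
is a subset of its scenario, hence one of the sets that can be picked from the literals of the
variables. -/
theorem alternation_checkStages {C : List Clause} {vars : List ℕ} {B : ℕ}
    (hB : 2 * vars.length ≤ B) (stages : List (T × ℕ))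
    (hst : ∀ st ∈ stages, (ScenarioEncoding.word st.1).length ≤ B ∧
      ∀ E ∈ ScenarioEncoding.parts st.1, ∀ l ∈ E, l.1 ∈ vars) : ∀ s : List Literal,
    alternation B false (2 * stages.length)
      (fun ws => CheckStages stages.length (C, literalsOf vars) stages s ws) ↔
    Recoverable C (stages.map fun st => (ScenarioEncoding.scenarios st.1, st.2)) s.toFinset := by
  induction stages with
  | nil => exact fun s => Iff.rfl
  | cons st stages ih =>
    intro s
    obtain ⟨⟨hw, hE⟩, hst⟩ := List.forall_mem_cons.1 hst
    have ih := ih hst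
    -- Once `v` and `w` are fixed, the conditions of this stage are constant and can be moved out of
    -- the remaining quantifiers.
    have key : ∀ (v w : List Bool), alternation B false (2 * stages.length)
        (fun ws => CheckStages (st :: stages).length (C, literalsOf vars) (st :: stages) s
          (v :: w :: ws)) ↔
        (StageEncoding.Valid st.1 v → IsSolution C (StageEncoding.scenario st.1 v).toFinset
          (pick (literalsOf vars) w).toFinset ∧
        hamming s.toFinset (pick (literalsOf vars) w).toFinset ≤ st.2 ∧
        Recoverable C (stages.map fun st => (ScenarioEncoding.scenarios st.1, st.2))
          (pick (literalsOf vars) w).toFinset) := by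
      intro v w
      rw [← ih, ← alternation_const_and, ← alternation_const_and, ← alternation_const_imp]
      rfl
    rw [List.map_cons, Recoverable]
    have e : 2 * (st :: stages).length = (2 * stages.length + 1) + 1 := by
      rw [List.length_cons]; omega
    rw [e]
    change (∀ v : List Bool, v.length ≤ B → ∃ w : List Bool, w.length ≤ B ∧
      alternation B false (2 * stages.length)
        (fun ws => CheckStages (st :: stages).length (C, literalsOf vars) (st :: stages) s
          (v :: w :: ws))) ↔ _
    simp only [key]
    constructor
    · intro h σ hσ
      obtain ⟨v, hv, hval, rfl⟩ := StageEncoding.exists_scenario st.1 σ hσ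
      obtain ⟨w, _, h⟩ := h v (hv.trans hw)
      exact ⟨_, h hval⟩
    · intro h v _
      by_cases hval : StageEncoding.Valid st.1 v
      · obtain ⟨t, ht, ht'⟩ := h _ (StageEncoding.scenario_mem st.1 v hval)
        obtain ⟨w, hwl, rfl⟩ := exists_pick_toFinset_eq (vars := vars) (s := t) fun l hl => by
          obtain ⟨E, hE', hl⟩ := StageEncoding.scenario_subset st.1 v l
            (List.mem_toFinset.1 (ht.1 hl))
          exact hE E hE' l hl
        exact ⟨w, hwl.trans hB, fun _ => ⟨ht, ht'⟩⟩
      · exact ⟨[], Nat.zero_le _, fun h => absurd h hval⟩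

/-- The input word and the guesses are accepted by the verifier. -/
def Accepts (T : Type) [Enc T] [ScenarioEncoding T] [StageEncoding T] (m : ℕ) (x : List Γ')
    (ws : List (List Bool)) : Prop :=
  ((readInstance x : Instance T).word = x ∧ (readInstance x : Instance T).stages.length = m ∧
    (readInstance x : Instance T).WellFormed) ∧
  IsSolution (readInstance x : Instance T).clauses (readInstance x : Instance T).base.toFinset
    (pick (literalsOf (readInstance x : Instance T).vars) (ws.headD [])).toFinset ∧
  CheckStages m ((readInstance x : Instance T).clauses,
    literalsOf (readInstance x : Instance T).vars) (readInstance x : Instance T).stages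
    (pick (literalsOf (readInstance x : Instance T).vars) (ws.headD [])) ws.tail

theorem polyTime_accepts (m : ℕ) :
    PolyTime (fun p : List Γ' × List (List Bool) => Accepts T m p.1 p.2) := by
  obtain ⟨h₁, h₂, h₃, h₄⟩ := polyTime_readInstance (T := T)
  have g₁ : PolyTime (fun p : List Γ' × List (List Bool) => (readInstance p.1 : Instance T).clauses) := h₂.comp .fst
  have g₂ : PolyTime (fun p : List Γ' × List (List Bool) => literalsOf (readInstance p.1 : Instance T).vars) :=
    .flatMap (g := fun _ v => [(v, true), (v, false)]) (by fun_prop) (h₁.comp .fst)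
  have g₃ : PolyTime (fun p : List Γ' × List (List Bool) => pick (literalsOf (readInstance p.1 : Instance T).vars)
      (p.2.headD [])) := g₂.pick (by fun_prop)
  refine .and (.and (.eq (polyTime_word_readInstance.comp .fst) (by fun_prop))
    (.and (.length_eq (h₄.comp .fst) m) (polyTime_wellFormed.comp .fst)))
    (.and (.isSolution g₁ (h₃.comp .fst) g₃) ?_)
  exact (polyTime_checkStages m).comp (f := fun p : List Γ' × List (List Bool) => (((readInstance p.1 : Instance T).clauses,
    literalsOf (readInstance p.1 : Instance T).vars), (readInstance p.1 : Instance T).stages,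
    pick (literalsOf (readInstance p.1 : Instance T).vars) (p.2.headD []), p.2.tail))
    (.pair (g₁.pair g₂) (.pair (h₄.comp .fst) (.pair g₃ (by fun_prop))))

/-- The first guess is the solution of the base scenario. Every variable occupies at least one
symbol of the word, so two bits per variable fit into twice its length. -/
theorem alternation_solution_checkStages {I : Instance T} (hwf : I.WellFormed) :
    alternation (2 * I.word.length) true (2 * I.stages.length + 1) (fun ws =>
      IsSolution I.clauses I.base.toFinset (pick (literalsOf I.vars) (ws.headD [])).toFinset ∧
      CheckStages I.stages.length (I.clauses, literalsOf I.vars) I.stages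
        (pick (literalsOf I.vars) (ws.headD [])) ws.tail) ↔ I.IsYes := by
  have hvars : I.vars.length ≤ I.word.length := by
    refine (length_le_length_encodeList (e := encodeNumber) (fun n => ?_) I.vars).trans ?_
    · simp [encodeNumber]
    · simp only [Instance.word, List.length_append]; omega
  have hst : ∀ st ∈ I.stages, (ScenarioEncoding.word st.1).length ≤ 2 * I.word.length ∧
      ∀ E ∈ ScenarioEncoding.parts st.1, ∀ l ∈ E, l.1 ∈ I.vars := by
    refine fun st h => ⟨?_, (hwf.2.2 st h).1⟩
    have := length_le_length_encodeList_of_mem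
      (e := fun st : T × ℕ => ScenarioEncoding.word st.1 ++ encodeNumber st.2) h
    simp only [List.length_append] at this
    simp only [Instance.word, List.length_append]
    omega
  change (∃ w : List Bool, w.length ≤ 2 * I.word.length ∧ alternation (2 * I.word.length) false
    (2 * I.stages.length) (fun ws =>
      IsSolution I.clauses I.base.toFinset (pick (literalsOf I.vars) w).toFinset ∧
      CheckStages I.stages.length (I.clauses, literalsOf I.vars) I.stages
        (pick (literalsOf I.vars) w) ws)) ↔ _
  simp only [alternation_const_and,
    alternation_checkStages (Nat.mul_le_mul_left 2 hvars) I.stages hst]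
  constructor
  · exact fun ⟨w, _, h⟩ => ⟨_, h⟩
  · rintro ⟨s, hs, h⟩
    obtain ⟨w, hw, rfl⟩ := exists_pick_toFinset_eq (vars := I.vars) (s := s) fun l hl =>
      hwf.2.1 l (List.mem_toFinset.1 (hs.1 hl))
    exact ⟨w, hw.trans (Nat.mul_le_mul_left 2 hvars), hs, h⟩

/-- The checks of the format do not involve the guesses and are moved out; they say that `x` is the
word of a well-formed instance with `m` stages, namely of the one read from it. -/
theorem alternation_accepts (m : ℕ) (x : List Γ') :
    alternation (2 * x.length) true (2 * m + 1) (fun ws => Accepts T m x ws) ↔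
      x ∈ multiStage3Sat T m := by
  unfold Accepts
  rw [alternation_const_and]
  constructor
  · rintro ⟨⟨hx, rfl, hwf⟩, h⟩
    have := alternation_solution_checkStages hwf
    rw [hx] at this
    exact ⟨_, rfl, hwf, this.1 h, hx⟩
  · rintro ⟨I, rfl, hwf, hyes, rfl⟩
    rw [readInstance_word]
    exact ⟨⟨rfl, rfl, hwf⟩, (alternation_solution_checkStages hwf).2 hyes⟩

open Classical in
theorem multiStage3Sat_mem_sigmaP (T : Type) [Enc T] [ScenarioEncoding T] [StageEncoding T]
    (m : ℕ) : multiStage3Sat T m ∈ SigmaP Γ' (2 * m + 1) := by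
  refine ⟨fun a => decide (Accepts T m a.1 a.2), 2 * Polynomial.X,
    computable_of_polyTime _ (polyTime_accepts m).decide, fun x => ?_⟩
  simp only [decide_eq_true_eq, Polynomial.eval_mul, Polynomial.eval_X, Polynomial.eval_ofNat]
  exact (alternation_accepts m x).symm

end

end HDRR

theorem mainTheorem6 (m : ℕ) :
    HDRR.multiStage3Sat HDRR.XorDependencies m ∈
        HDRR.SigmaP Computability.Γ' (2 * m + 1) ∧
      HDRR.multiStage3Sat HDRR.GammaSets m ∈
        HDRR.SigmaP Computability.Γ' (2 * m + 1) :=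
  ⟨HDRR.multiStage3Sat_mem_sigmaP _ m, HDRR.multiStage3Sat_mem_sigmaP _ m⟩
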